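/- Let $G=(V,E)$ be a finite simple graph that is maximal planar: it has an embedding in the plane in which edges are simple arcs that meet only at common endpoints (and pass through no other vertex), and no edge can be added to $G$ on the same vertex set without violating planarity. Let $K$ be the set of 3-cliques (sets of three mutually adjacent vertices) of $G$. Removing a 3-clique $k$ divides the remaining vertices into two parts $S,S'$ such that every path from $S$ to $S'$ meets $k$; both parts are non-empty if such a division exists (then $k$ is called separating), and otherwise one of them is empty. The interior $G_{in}(k)$ is the part with fewer vertices; if the two parts have equally many vertices, the interior is either one of them, chosen arbitrarily. For $k,k'\in K$ write $k\preceq k'$ if $k\cup G_{in}(k)\subseteq k'\cup G_{in}(k')$. Say that $x\in K$ covers $y\in K$ if $y\preceq x$, $y\ne x$, and there is no $z\in K\setminus\{x,y\}$ with $y\preceq z\preceq x$. The hierarchical graph $H$ is the directed graph with vertex set $K$ and a directed edge from $y$ to $x$ (outgoing from $y$, incoming to $x$) whenever $x$ covers $y$. Theorem. (a) A vertex of $H$ can have several incoming edges: there are a maximal planar graph $G$, a choice of interiors of its 3-cliques, and a 3-clique of $G$ with at least three incoming edges in $H$. (b) For every finite maximal planar graph $G$ and every choice of interiors, each vertex of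 $H$ has at most one outgoing edge; that is, each 3-clique is covered by at most one other 3-clique. -/

import Mathlib

namespace CliqueHierarchy

universe u

/-- `A` is a simple arc (an injective continuous image of `[0, 1]`) with endpoints `p` and `q` in
the Euclidean plane. -/
def IsArc (A : Set (EuclideanSpace ℝ (Fin 2))) (p q : EuclideanSpace ℝ (Fin 2)) : Prop :=
  ∃ γ : Path p q, Function.Injective γ ∧ Set.range γ = A

/-- An embedding of a simple graph in the plane: distinct vertices are distinct points, every edge
is a simple arc between its two endpoints which passes through no other vertex, and two different
edges meet only at common endpoints. (The values of `arc` off the edge set play no role.) -/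
structure PlaneEmbedding {V : Type u} (G : SimpleGraph V) where
  point : V → EuclideanSpace ℝ (Fin 2)
  arc : Sym2 V → Set (EuclideanSpace ℝ (Fin 2))
  point_injective : Function.Injective point
  isArc : ∀ u v : V, G.Adj u v → IsArc (arc s(u, v)) (point u) (point v)
  vertex_on_arc : ∀ e ∈ G.edgeSet, ∀ w : V, point w ∈ arc e → w ∈ e
  arc_inter_arc : ∀ e ∈ G.edgeSet, ∀ f ∈ G.edgeSet, e ≠ f →
    ∀ x ∈ arc e ∩ arc f, ∃ w : V, w ∈ e ∧ w ∈ f ∧ x = point w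

/-- A graph is planar if it has an embedding in the plane. -/
def IsPlanar {V : Type u} (G : SimpleGraph V) : Prop :=
  Nonempty (PlaneEmbedding G)

/-- A graph is maximal planar if it is planar and no proper supergraph on the same vertex set is
planar. -/
def IsMaximalPlanar {V : Type u} (G : SimpleGraph V) : Prop :=
  IsPlanar G ∧ ∀ G' : SimpleGraph V, G < G' → ¬ IsPlanar G'

/-- The set `K` of 3-cliques of `G`. -/
abbrev ThreeClique {V : Type u} (G : SimpleGraph V) : Type u :=
  {k : Finset V // G.IsNClique 3 k}

/-- `k` divides `G` into the (possibly empty) vertex sets `S` and `S'`: they partition the vertices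
outside `k`, and every path from `S` to `S'` contains a vertex of `k`. -/
structure Divides {V : Type u} (G : SimpleGraph V) (k : ThreeClique G) (S S' : Set V) : Prop where
  disjoint_left : Disjoint S (k.1 : Set V)
  disjoint_right : Disjoint S' (k.1 : Set V)
  disjoint : Disjoint S S'
  cover : S ∪ (k.1 : Set V) ∪ S' = Set.univ
  path_meets : ∀ i ∈ S, ∀ j ∈ S', ∀ p : G.Walk i j, p.IsPath → ∃ v ∈ p.support, v ∈ k.1

/-- A 3-clique is separating if it divides `G` into two non-empty parts. -/
def IsSeparating {V : Type u} (G : SimpleGraph V) (k : ThreeClique G) : Prop :=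
  ∃ S S' : Set V, Divides G k S S' ∧ S.Nonempty ∧ S'.Nonempty

/-- `S` and `S'` are the two parts obtained upon removal of `k`. Both are non-empty if `k` is
separating; otherwise one of them is necessarily empty. -/
def AreSides {V : Type u} (G : SimpleGraph V) (k : ThreeClique G) (S S' : Set V) : Prop :=
  Divides G k S S' ∧ (IsSeparating G k → S.Nonempty ∧ S'.Nonempty)

/-- A choice of interior (vertex set) for every 3-clique: one of the two sides, of order at most
that of the other side. If the two orders are equal, either side may be chosen. -/
structure InteriorChoice {V : Type u} (G : SimpleGraph V) where
  interior : ThreeClique G → Set V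
  isInterior : ∀ k : ThreeClique G, ∃ S' : Set V,
    AreSides G k (interior k) S' ∧ (interior k).ncard ≤ S'.ncard

/-- The relation `k ≼ k'`: the subgraph induced on `k` and its interior is contained in the
subgraph induced on `k'` and its interior. -/
def Below {V : Type u} {G : SimpleGraph V} (I : InteriorChoice G) (k k' : ThreeClique G) : Prop :=
  (k.1 : Set V) ∪ I.interior k ⊆ (k'.1 : Set V) ∪ I.interior k'

/-- `x` covers `y`: `y` lies below `x`, is different from `x`, and nothing else lies between. -/
def Covers {V : Type u} {G : SimpleGraph V} (I : InteriorChoice G) (x y : ThreeClique G) : Prop :=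
  Below I y x ∧ y ≠ x ∧ ¬ ∃ z : ThreeClique G, z ≠ x ∧ z ≠ y ∧ Below I y z ∧ Below I z x

/-- The hierarchical graph `H`: the vertices are the 3-cliques, and there is a directed edge from
`y` to `x` if `x` covers `y`. -/
def hierarchicalGraph {V : Type u} {G : SimpleGraph V} (I : InteriorChoice G) :
    Digraph (ThreeClique G) where
  Adj y x := Covers I x y

/-- The directed edges of a digraph that end at `x`. -/
def incomingEdges {K : Type u} (H : Digraph K) (x : K) : Set (K × K) :=
  {e | H.Adj e.1 e.2 ∧ e.2 = x}

/-- The directed edges of a digraph that start at `x`. -/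
def outgoingEdges {K : Type u} (H : Digraph K) (x : K) : Set (K × K) :=
  {e | H.Adj e.1 e.2 ∧ e.1 = x}

end CliqueHierarchy

/-! ### Winding numbers and the van Kampen relations -/

namespace CliqueHierarchy

/-! Part (a) is witnessed by $K_5$ minus an edge: the triangle on its three vertices of degree four
separates the other two, and taking one of them as the interior puts three facial triangles directly
below it.

For part (b), everything rests on the sides of a separating triangle of a maximal planar graph.
First, each vertex $v$ of the triangle has a neighbour on each side. Otherwise, if $b,c$ are its
other vertices, the ends of the edge $bc$ would separate one side from the other side together with
$v$; but an edge between these two sets could then be drawn, against maximality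
(`IsMaximalPlanar.exists_adj_of_edge`). Second, each side is connected: two components on one side
and one on the other, each adjacent to all three vertices of the triangle, would form a $K_{3,3}$
minor (`Separates.isLinked`). So a connected side of one triangle that avoids another triangle lies
entirely on one side of the latter. If $x'$ does not enter the exterior of $x$, it follows that
$x'\preceq x$, unless the exterior of $x$ lies in the interior of $x'$; comparing orders then forces
$x=x'$, which is how ties are handled. Two distinct covers of $y$ are incomparable, hence each
avoids the interior of the other; their interiors then cannot overlap, so $y$ lies inside $x$
itself, a contradiction (`Covers.unique`).

The topological input avoids the Jordan curve theorem and Euler's formula. A finite graph is planar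
exactly when it is a minor of the square grid: a drawing is pixelated at a fine scale
(`IsPlanar.exists_isGridModel`), and a grid minor is drawn by collapsing spanning trees of its parts
one leaf at a time (`IsGridModel.isPlanar`). Hence minors of planar graphs are planar, and adding an
edge becomes combinatorial: after halving the mesh, a tree in the grid has connected complement, so
a path around it carries the new edge (`IsGridModel.exists_add_edge`). Nonplanarity of $K_5$ and
$K_{3,3}$ is a parity argument on winding numbers of edges around vertices. -/

open Complex in
/-- The change of `log (α t - w)` as `t` runs from `0` to `1`, along a continuous branch. -/
noncomputable def logChange (α : ℝ → ℂ) (w : ℂ) : ℂ :=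
  open Classical in
  if h : ∃ L : ℝ → ℂ, Continuous L ∧ ∀ t, Complex.exp (L t) = α t - w then
    h.choose 1 - h.choose 0 else 0

/-- The range is a connected subset of the countable set $2\pi i\mathbb Z$, hence a point. This
makes the change of a logarithm independent of the branch. -/
theorem eq_of_continuous_exp_eq_one {g : ℝ → ℂ} (hg : Continuous g)
    (h : ∀ t, Complex.exp (g t) = 1) (s t : ℝ) : g s = g t := by
  have hc : (Set.range g).Countable := by
    refine (Set.countable_range fun n : ℤ => (n : ℂ) * (2 * Real.pi * Complex.I)).mono ?_
    rintro _ ⟨t, rfl⟩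
    obtain ⟨n, hn⟩ := Complex.exp_eq_one_iff.1 (h t)
    exact ⟨n, hn.symm⟩
  exact hc.isTotallyDisconnected _ subset_rfl (isPreconnected_range hg) ⟨s, rfl⟩ ⟨t, rfl⟩

theorem logChange_eq {α : ℝ → ℂ} {w : ℂ} {L : ℝ → ℂ} (hL : Continuous L)
    (h : ∀ t, Complex.exp (L t) = α t - w) : logChange α w = L 1 - L 0 := by
  have hex : ∃ L : ℝ → ℂ, Continuous L ∧ ∀ t, Complex.exp (L t) = α t - w := ⟨L, hL, h⟩
  rw [logChange, dif_pos hex]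
  have key := eq_of_continuous_exp_eq_one (hex.choose_spec.1.sub hL) (fun t => by
    have hne : Complex.exp (L t) ≠ 0 := Complex.exp_ne_zero _
    rw [Pi.sub_apply, Complex.exp_sub, hex.choose_spec.2 t, ← h t, div_self hne]) 0 1
  simp only [Pi.sub_apply] at key
  linear_combination -key

/-- The change of the argument of `α s - β t` around the boundary of the unit square is zero. -/
theorem logChange_square {α β : ℝ → ℂ} (hα : Continuous α) (hβ : Continuous β)
    (h : ∀ s t, α s ≠ β t) :
    logChange α (β 0) + logChange β (α 1) - logChange α (β 1) - logChange β (α 0) = 0 := by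
  -- A single logarithm $f$ of $\alpha(s)-\beta(t)$ on the whole plane computes all four sides of
  -- the square, so their changes telescope.
  have hsc : IsSimplyConnected (Set.univ : Set (ℝ × ℝ)) :=
    have := (convex_univ (𝕜 := ℝ) (E := ℝ × ℝ)).contractibleSpace Set.univ_nonempty
    SimplyConnectedSpace.ofContractible _
  obtain ⟨f, hf, hfe⟩ := Complex.exists_continuousOn_eqOn_exp_comp hsc isOpen_univ
    (g := fun p : ℝ × ℝ => α p.1 - β p.2) (by fun_prop) (by
      rintro ⟨p, -, hp⟩
      exact h _ _ (sub_eq_zero.1 hp))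
  have hf : Continuous f := continuousOn_univ.1 hf
  have hfe : ∀ s t, Complex.exp (f (s, t)) = α s - β t := fun s t => hfe (Set.mem_univ (s, t))
  have h1 : ∀ t₀, logChange α (β t₀) = f (1, t₀) - f (0, t₀) := fun t₀ =>
    logChange_eq (L := fun s => f (s, t₀)) (by fun_prop) fun s => hfe s t₀
  have h2 : ∀ s₀, logChange β (α s₀) = f (s₀, 1) - f (s₀, 0) := fun s₀ => by
    -- On the sides with $s$ fixed the roles are exchanged; adding $\pi i$ to $f$ accounts for the
    -- sign of $\beta(t)-\alpha(s)$ and cancels in the change.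
    rw [logChange_eq (L := fun t => f (s₀, t) + Real.pi * Complex.I) (by fun_prop) fun t => ?_]
    · ring
    · rw [Complex.exp_add, hfe, Complex.exp_pi_mul_I]; ring
  rw [h1, h1, h2, h2]; ring

theorem exp_logChange {α : ℝ → ℂ} {w : ℂ} (hα : Continuous α) (h : ∀ t, α t ≠ w) :
    ∃ L : ℝ → ℂ, Continuous L ∧ ∀ t, Complex.exp (L t) = α t - w := by
  have hsc : IsSimplyConnected (Set.univ : Set ℝ) :=
    have := (convex_univ (𝕜 := ℝ) (E := ℝ)).contractibleSpace Set.univ_nonempty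
    SimplyConnectedSpace.ofContractible _
  obtain ⟨f, hf, hfe⟩ := Complex.exists_continuousOn_eqOn_exp_comp hsc isOpen_univ
    (g := fun t : ℝ => α t - w) (by fun_prop) (by
      rintro ⟨p, -, hp⟩
      exact h _ (sub_eq_zero.1 hp))
  exact ⟨f, continuousOn_univ.1 hf, fun t => hfe (Set.mem_univ t)⟩

section
variable {ι : Type*} [LinearOrder ι]

/-- A logarithm of `z u - z w`, normalised such that `pairLog z u w` and `pairLog z w u` differ
by `π i`. -/
noncomputable def pairLog (z : ι → ℂ) (u w : ι) : ℂ :=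
  if u < w then Complex.log (z u - z w) else Complex.log (z w - z u) + Real.pi * Complex.I

/-- The sign of the comparison of `u` with `w`. -/
def orderSign (u w : ι) : ℤ := if u < w then -1 else 1

theorem exp_pairLog {z : ι → ℂ} {u w : ι} (h : z u ≠ z w) :
    Complex.exp (pairLog z u w) = z u - z w := by
  unfold pairLog
  split_ifs
  · rw [Complex.exp_log (sub_ne_zero.2 h)]
  · rw [Complex.exp_add, Complex.exp_log (sub_ne_zero.2 h.symm), Complex.exp_pi_mul_I]; ring

theorem pairLog_sub_pairLog {z : ι → ℂ} {u w : ι} (h : u ≠ w) :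
    pairLog z u w - pairLog z w u = orderSign u w * (Real.pi * Complex.I) := by
  unfold pairLog orderSign
  rcases lt_or_gt_of_ne h with h | h
  · simp [h, h.not_gt]
  · simp [h, h.not_gt]

/-- Two logarithms of the same number differ by a multiple of $2\pi i$. Measuring against logarithms
fixed for each pair of vertices turns the winding of an edge around a vertex into an integer. -/
theorem exists_logChange_eq {z : ι → ℂ} {α : ℝ → ℂ} {i j k : ι} (hα : Continuous α)
    (h0 : α 0 = z i) (h1 : α 1 = z j) (h : ∀ t, α t ≠ z k) :
    ∃ n : ℤ, logChange α (z k) =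
      pairLog z j k - pairLog z i k + n * (2 * Real.pi * Complex.I) := by
  obtain ⟨L, hL, hLe⟩ := exp_logChange hα h
  have e1 : Complex.exp (L 1) = Complex.exp (pairLog z j k) := by
    rw [hLe, exp_pairLog (h1 ▸ h 1), h1]
  have e0 : Complex.exp (L 0) = Complex.exp (pairLog z i k) := by
    rw [hLe, exp_pairLog (h0 ▸ h 0), h0]
  obtain ⟨m, hm⟩ := Complex.exp_eq_exp_iff_exists_int.1 e1
  obtain ⟨n, hn⟩ := Complex.exp_eq_exp_iff_exists_int.1 e0
  refine ⟨m - n, ?_⟩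
  rw [logChange_eq hL hLe, hm, hn]
  push_cast; ring

/-- The van Kampen relations between the winding numbers of disjoint edges of a plane drawing. -/
theorem exists_winding {z : ι → ℂ} {P : ι → ι → ℝ → ℂ} {adj : ι → ι → Prop}
    (hc : ∀ i j, i < j → adj i j → Continuous (P i j))
    (h0 : ∀ i j, i < j → adj i j → P i j 0 = z i) (h1 : ∀ i j, i < j → adj i j → P i j 1 = z j)
    (hd : ∀ i j k l, i < j → k < l → adj i j → adj k l → i ≠ k → i ≠ l → j ≠ k → j ≠ l →
      ∀ s t, P i j s ≠ P k l t) :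
    ∃ n : ι → ι → ι → ℤ, ∀ i j k l, i < j → k < l → adj i j → adj k l →
      i ≠ k → i ≠ l → j ≠ k → j ≠ l →
      orderSign j k + orderSign l j + orderSign i l + orderSign k i +
        2 * (n i j k + n k l j - n i j l - n k l i) = 0 := by
  have key : ∀ i j k, ∃ n : ℤ, i < j → adj i j → (∀ t, P i j t ≠ z k) →
      logChange (P i j) (z k) =
        pairLog z j k - pairLog z i k + n * (2 * Real.pi * Complex.I) := fun i j k => by
    by_cases h : i < j ∧ adj i j ∧ ∀ t, P i j t ≠ z k
    · obtain ⟨n, hn⟩ := exists_logChange_eq (hc i j h.1 h.2.1) (h0 i j h.1 h.2.1)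
        (h1 i j h.1 h.2.1) h.2.2
      exact ⟨n, fun _ _ _ => hn⟩
    · exact ⟨0, fun a b c => (h ⟨a, b, c⟩).elim⟩
  choose n hn using key
  refine ⟨n, fun i j k l hij hkl aij akl hik hil hjk hjl => ?_⟩
  have hd1 := hd i j k l hij hkl aij akl hik hil hjk hjl
  have sq := logChange_square (hc i j hij aij) (hc k l hkl akl) hd1
  rw [h0 k l hkl akl, h1 k l hkl akl, h0 i j hij aij, h1 i j hij aij,
    hn i j k hij aij fun t => h0 k l hkl akl ▸ hd1 t 0,
    hn i j l hij aij fun t => h1 k l hkl akl ▸ hd1 t 1,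
    hn k l i hkl akl fun t => h0 i j hij aij ▸ (hd1 0 t).symm,
    hn k l j hkl akl fun t => h1 i j hij aij ▸ (hd1 1 t).symm] at sq
  have a1 := pairLog_sub_pairLog (z := z) hjk
  have a2 := pairLog_sub_pairLog (z := z) hjl.symm
  have a3 := pairLog_sub_pairLog (z := z) hil
  have a4 := pairLog_sub_pairLog (z := z) hik.symm
  have hpi : (Real.pi * Complex.I : ℂ) ≠ 0 :=
    mul_ne_zero (Complex.ofReal_ne_zero.2 Real.pi_ne_zero) Complex.I_ne_zero
  -- The eight fixed logarithms pair up as $(u,w)$ and $(w,u)$; each pair leaves $\pm\pi i$, so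
  -- dividing the square relation by $\pi i$ gives an equation in integers.
  have : ((orderSign j k + orderSign l j + orderSign i l + orderSign k i +
        2 * (n i j k + n k l j - n i j l - n k l i) : ℤ) : ℂ) * (Real.pi * Complex.I) = 0 := by
    push_cast
    linear_combination sq - a1 - a2 - a3 - a4
  exact_mod_cast (mul_eq_zero.1 this).resolve_right hpi

theorem PlaneEmbedding.exists_winding {ι : Type*} [LinearOrder ι] {G : SimpleGraph ι}
    (D : PlaneEmbedding G) :
    ∃ n : ι → ι → ι → ℤ, ∀ i j k l, i < j → k < l → G.Adj i j → G.Adj k l →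
      i ≠ k → i ≠ l → j ≠ k → j ≠ l →
      orderSign j k + orderSign l j + orderSign i l + orderSign k i +
        2 * (n i j k + n k l j - n i j l - n k l i) = 0 := by
  -- Only the disjointness and continuity of arcs without a common endpoint matter here, so the
  -- plane may be read as $\mathbb C$ and the paths extended constantly to $\mathbb R$.
  let F : EuclideanSpace ℝ (Fin 2) → ℂ := fun x => ⟨x 0, x 1⟩
  have hF : Continuous F := by
    have : F = fun x => ((x 0 : ℝ) : ℂ) + ((x 1 : ℝ) : ℂ) * Complex.I := by
      funext x; apply Complex.ext <;> simp [F]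
    rw [this]; fun_prop
  have hinj : Function.Injective F := fun x y h => by
    have h0 : x 0 = y 0 := congrArg Complex.re h
    have h1 : x 1 = y 1 := congrArg Complex.im h
    ext i; fin_cases i
    · exact h0
    · exact h1
  have key : ∀ i j, ∃ γ : ℝ → EuclideanSpace ℝ (Fin 2), G.Adj i j →
      Continuous γ ∧ γ 0 = D.point i ∧ γ 1 = D.point j ∧ ∀ t, γ t ∈ D.arc s(i, j) := fun i j => by
    by_cases h : G.Adj i j
    · obtain ⟨γ, -, hγ⟩ := D.isArc i j h
      refine ⟨γ.extend, fun _ => ⟨γ.continuous_extend, by simp, by simp, fun t => ?_⟩⟩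
      rw [← hγ, ← γ.extend_range]
      exact ⟨t, rfl⟩
    · exact ⟨fun _ => 0, fun h' => (h h').elim⟩
  choose γ hγ using key
  refine CliqueHierarchy.exists_winding (z := fun i => F (D.point i))
    (P := fun i j t => F (γ i j t)) (adj := G.Adj)
    (fun i j _ h => hF.comp (hγ i j h).1) (fun i j _ h => by rw [(hγ i j h).2.1])
    (fun i j _ h => by rw [(hγ i j h).2.2.1])
    fun i j k l _ _ hij hkl hik hil hjk hjl s t he => ?_
  obtain ⟨w, hw1, hw2, -⟩ := D.arc_inter_arc s(i, j) hij s(k, l) hkl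
    (by simp [hik, hil]) (γ i j s) ⟨(hγ i j hij).2.2.2 s, hinj he ▸ (hγ k l hkl).2.2.2 t⟩
  rw [Sym2.mem_iff] at hw1 hw2
  rcases hw1 with rfl | rfl <;> rcases hw2 with h | h <;> contradiction

end

/-! ### Nonplanarity of $K_5$ and $K_{3,3}$ -/

/-- A plane graph does not contain five mutually adjacent vertices. -/
theorem PlaneEmbedding.false_of_K5 {ι : Type*} [LinearOrder ι] {G : SimpleGraph ι}
    (D : PlaneEmbedding G) {a b c d e : ι} (lab : a < b) (lbc : b < c) (lcd : c < d) (lde : d < e)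
    (_ : G.Adj a b) (_ : G.Adj a c) (_ : G.Adj a d) (_ : G.Adj a e) (_ : G.Adj b c) (_ : G.Adj b d) (_ : G.Adj b e) (_ : G.Adj c d) (_ : G.Adj c e) (_ : G.Adj d e) : False := by
  obtain ⟨n, hn⟩ := D.exists_winding
  have lac := lab.trans lbc
  have lbd := lbc.trans lcd
  have lce := lcd.trans lde
  have lad := lac.trans lcd
  have lbe := lbd.trans lde
  have lae := lad.trans lde
  have s1 : ∀ {u w : ι}, u < w → orderSign u w = -1 := fun h => if_pos h
  have s2 : ∀ {u w : ι}, u < w → orderSign w u = 1 := fun h => if_neg h.not_gt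
  have e1 := hn a b c d lab lcd ‹_› ‹_› (lac.ne) (lad.ne) (lbc.ne) (lbd.ne)
  rw [s1 lbc, s2 lbd, s1 lad, s2 lac] at e1
  have e2 := hn a b c e lab lce ‹_› ‹_› (lac.ne) (lae.ne) (lbc.ne) (lbe.ne)
  rw [s1 lbc, s2 lbe, s1 lae, s2 lac] at e2
  have e3 := hn a b d e lab lde ‹_› ‹_› (lad.ne) (lae.ne) (lbd.ne) (lbe.ne)
  rw [s1 lbd, s2 lbe, s1 lae, s2 lad] at e3
  have e4 := hn a c b d lac lbd ‹_› ‹_› (lab.ne) (lad.ne) (lbc.ne') (lcd.ne)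
  rw [s2 lbc, s2 lcd, s1 lad, s2 lab] at e4
  have e5 := hn a c b e lac lbe ‹_› ‹_› (lab.ne) (lae.ne) (lbc.ne') (lce.ne)
  rw [s2 lbc, s2 lce, s1 lae, s2 lab] at e5
  have e6 := hn a c d e lac lde ‹_› ‹_› (lad.ne) (lae.ne) (lcd.ne) (lce.ne)
  rw [s1 lcd, s2 lce, s1 lae, s2 lad] at e6
  have e7 := hn a d b c lad lbc ‹_› ‹_› (lab.ne) (lac.ne) (lbd.ne') (lcd.ne')
  rw [s2 lbd, s1 lcd, s1 lac, s2 lab] at e7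
  have e8 := hn a d b e lad lbe ‹_› ‹_› (lab.ne) (lae.ne) (lbd.ne') (lde.ne)
  rw [s2 lbd, s2 lde, s1 lae, s2 lab] at e8
  have e9 := hn a d c e lad lce ‹_› ‹_› (lac.ne) (lae.ne) (lcd.ne') (lde.ne)
  rw [s2 lcd, s2 lde, s1 lae, s2 lac] at e9
  have e10 := hn a e b c lae lbc ‹_› ‹_› (lab.ne) (lac.ne) (lbe.ne') (lce.ne')
  rw [s2 lbe, s1 lce, s1 lac, s2 lab] at e10
  have e11 := hn a e b d lae lbd ‹_› ‹_› (lab.ne) (lad.ne) (lbe.ne') (lde.ne')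
  rw [s2 lbe, s1 lde, s1 lad, s2 lab] at e11
  have e12 := hn a e c d lae lcd ‹_› ‹_› (lac.ne) (lad.ne) (lce.ne') (lde.ne')
  rw [s2 lce, s1 lde, s1 lad, s2 lac] at e12
  have e13 := hn b c d e lbc lde ‹_› ‹_› (lbd.ne) (lbe.ne) (lcd.ne) (lce.ne)
  rw [s1 lcd, s2 lce, s1 lbe, s2 lbd] at e13
  have e14 := hn b d c e lbd lce ‹_› ‹_› (lbc.ne) (lbe.ne) (lcd.ne') (lde.ne)
  rw [s2 lcd, s2 lde, s1 lbe, s2 lbc] at e14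
  have e15 := hn b e c d lbe lcd ‹_› ‹_› (lbc.ne) (lbd.ne) (lce.ne') (lde.ne')
  rw [s2 lce, s1 lde, s1 lbd, s2 lbc] at e15
  clear hn s1 s2
  -- Add the 15 equations modulo 4. The four signs sum to 2 when the two edges interleave in the
  -- vertex order and to 0 otherwise, and there are 5 interleaved pairs. Every winding number occurs
  -- in exactly two equations with coefficient $\pm2$, so it drops out, leaving $10\equiv0$.
  omega

/-- A plane graph does not contain a complete bipartite graph on three and three vertices. -/
theorem PlaneEmbedding.false_of_K33 {ι : Type*} [LinearOrder ι] {G : SimpleGraph ι}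
    (D : PlaneEmbedding G) {a b c d e f : ι} (lab : a < b) (lbc : b < c) (lcd : c < d) (lde : d < e) (lef : e < f)
    (_ : G.Adj a d) (_ : G.Adj a e) (_ : G.Adj a f) (_ : G.Adj b d) (_ : G.Adj b e) (_ : G.Adj b f) (_ : G.Adj c d) (_ : G.Adj c e) (_ : G.Adj c f) : False := by
  obtain ⟨n, hn⟩ := D.exists_winding
  have lac := lab.trans lbc
  have lbd := lbc.trans lcd
  have lce := lcd.trans lde
  have ldf := lde.trans lef
  have lad := lac.trans lcd
  have lbe := lbd.trans lde
  have lcf := lce.trans lef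
  have lae := lad.trans lde
  have lbf := lbe.trans lef
  have laf := lae.trans lef
  have s1 : ∀ {u w : ι}, u < w → orderSign u w = -1 := fun h => if_pos h
  have s2 : ∀ {u w : ι}, u < w → orderSign w u = 1 := fun h => if_neg h.not_gt
  have e1 := hn a d b e lad lbe ‹_› ‹_› (lab.ne) (lae.ne) (lbd.ne') (lde.ne)
  rw [s2 lbd, s2 lde, s1 lae, s2 lab] at e1
  have e2 := hn a d b f lad lbf ‹_› ‹_› (lab.ne) (laf.ne) (lbd.ne') (ldf.ne)
  rw [s2 lbd, s2 ldf, s1 laf, s2 lab] at e2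
  have e3 := hn a d c e lad lce ‹_› ‹_› (lac.ne) (lae.ne) (lcd.ne') (lde.ne)
  rw [s2 lcd, s2 lde, s1 lae, s2 lac] at e3
  have e4 := hn a d c f lad lcf ‹_› ‹_› (lac.ne) (laf.ne) (lcd.ne') (ldf.ne)
  rw [s2 lcd, s2 ldf, s1 laf, s2 lac] at e4
  have e5 := hn a e b d lae lbd ‹_› ‹_› (lab.ne) (lad.ne) (lbe.ne') (lde.ne')
  rw [s2 lbe, s1 lde, s1 lad, s2 lab] at e5
  have e6 := hn a e b f lae lbf ‹_› ‹_› (lab.ne) (laf.ne) (lbe.ne') (lef.ne)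
  rw [s2 lbe, s2 lef, s1 laf, s2 lab] at e6
  have e7 := hn a e c d lae lcd ‹_› ‹_› (lac.ne) (lad.ne) (lce.ne') (lde.ne')
  rw [s2 lce, s1 lde, s1 lad, s2 lac] at e7
  have e8 := hn a e c f lae lcf ‹_› ‹_› (lac.ne) (laf.ne) (lce.ne') (lef.ne)
  rw [s2 lce, s2 lef, s1 laf, s2 lac] at e8
  have e9 := hn a f b d laf lbd ‹_› ‹_› (lab.ne) (lad.ne) (lbf.ne') (ldf.ne')
  rw [s2 lbf, s1 ldf, s1 lad, s2 lab] at e9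
  have e10 := hn a f b e laf lbe ‹_› ‹_› (lab.ne) (lae.ne) (lbf.ne') (lef.ne')
  rw [s2 lbf, s1 lef, s1 lae, s2 lab] at e10
  have e11 := hn a f c d laf lcd ‹_› ‹_› (lac.ne) (lad.ne) (lcf.ne') (ldf.ne')
  rw [s2 lcf, s1 ldf, s1 lad, s2 lac] at e11
  have e12 := hn a f c e laf lce ‹_› ‹_› (lac.ne) (lae.ne) (lcf.ne') (lef.ne')
  rw [s2 lcf, s1 lef, s1 lae, s2 lac] at e12
  have e13 := hn b d c e lbd lce ‹_› ‹_› (lbc.ne) (lbe.ne) (lcd.ne') (lde.ne)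
  rw [s2 lcd, s2 lde, s1 lbe, s2 lbc] at e13
  have e14 := hn b d c f lbd lcf ‹_› ‹_› (lbc.ne) (lbf.ne) (lcd.ne') (ldf.ne)
  rw [s2 lcd, s2 ldf, s1 lbf, s2 lbc] at e14
  have e15 := hn b e c d lbe lcd ‹_› ‹_› (lbc.ne) (lbd.ne) (lce.ne') (lde.ne')
  rw [s2 lce, s1 lde, s1 lbd, s2 lbc] at e15
  have e16 := hn b e c f lbe lcf ‹_› ‹_› (lbc.ne) (lbf.ne) (lce.ne') (lef.ne)
  rw [s2 lce, s2 lef, s1 lbf, s2 lbc] at e16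
  have e17 := hn b f c d lbf lcd ‹_› ‹_› (lbc.ne) (lbd.ne) (lcf.ne') (ldf.ne')
  rw [s2 lcf, s1 ldf, s1 lbd, s2 lbc] at e17
  have e18 := hn b f c e lbf lce ‹_› ‹_› (lbc.ne) (lbe.ne) (lcf.ne') (lef.ne')
  rw [s2 lcf, s1 lef, s1 lbe, s2 lbc] at e18
  clear hn s1 s2
  -- The same count as for $K_5$: 9 of the 18 pairs interleave and every winding number again occurs
  -- twice, so the sum would give $18\equiv0$ modulo 4.
  omega

end CliqueHierarchy
-- Chains, linked sets and grid models
namespace CliqueHierarchy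

section Connectivity
variable {α : Type*} {r : α → α → Prop} {s t : Set α} {x y z : α}

/-- `x` and `y` are joined by an `r`-chain inside `s`. -/
def Joined (r : α → α → Prop) (s : Set α) : α → α → Prop :=
  Relation.ReflTransGen fun a b => r a b ∧ a ∈ s ∧ b ∈ s

/-- Any two elements of `s` are joined by an `r`-chain inside `s`. -/
def IsLinked (r : α → α → Prop) (s : Set α) : Prop :=
  ∀ x ∈ s, ∀ y ∈ s, Joined r s x y

theorem Joined.mono (h : s ⊆ t) (hxy : Joined r s x y) : Joined r t x y := by
  induction hxy with
  | refl => exact Relation.ReflTransGen.refl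
  | tail _ h' ih => exact ih.tail ⟨h'.1, h h'.2.1, h h'.2.2⟩

theorem Joined.trans (hxy : Joined r s x y) (hyz : Joined r s y z) : Joined r s x z :=
  Relation.ReflTransGen.trans hxy hyz

theorem Joined.single (h : r x y) (hx : x ∈ s) (hy : y ∈ s) : Joined r s x y :=
  Relation.ReflTransGen.single ⟨h, hx, hy⟩

theorem Joined.symm (hr : ∀ a b, r a b → r b a) (hxy : Joined r s x y) : Joined r s y x := by
  induction hxy with
  | refl => exact Relation.ReflTransGen.refl
  | tail _ h ih => exact Relation.ReflTransGen.head ⟨hr _ _ h.1, h.2.2, h.2.1⟩ ih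

theorem Joined.mem_right (hxy : Joined r s x y) (hx : x ∈ s) : y ∈ s := by
  rcases Relation.ReflTransGen.cases_tail hxy with h | ⟨_, _, h⟩
  · exact h ▸ hx
  · exact h.2.2

theorem IsLinked.of_root (hr : ∀ a b, r a b → r b a) (h : ∀ y ∈ s, Joined r s x y) :
    IsLinked r s := fun a ha b hb => ((h a ha).symm hr).trans (h b hb)

theorem isLinked_singleton : IsLinked r {x} := by
  rintro a rfl b rfl
  exact Relation.ReflTransGen.refl

theorem IsLinked.union (hr : ∀ a b, r a b → r b a) (hs : IsLinked r s) (ht : IsLinked r t)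
    (hx : x ∈ s) (hy : y ∈ t) (hxy : r x y ∨ x = y) : IsLinked r (s ∪ t) := by
  refine IsLinked.of_root hr (x := x) ?_
  rintro z (hz | hz)
  · exact (hs x hx z hz).mono Set.subset_union_left
  · have h := (ht y hy z hz).mono (Set.subset_union_right (s := s))
    rcases hxy with hxy | rfl
    · exact (Joined.single hxy (Or.inl hx) (Or.inr hy)).trans h
    · exact h

theorem IsLinked.insert_adj (hr : ∀ a b, r a b → r b a) (hs : IsLinked r s) (hx : x ∈ s)
    (hxy : r x y) : IsLinked r (insert y s) := by
  rw [← Set.union_singleton]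
  exact hs.union hr isLinked_singleton hx rfl (Or.inl hxy)

theorem IsLinked.exists_boundary (hs : IsLinked r s) (ht : t ⊆ s) (hx : x ∈ t) (hne : t ≠ s) :
    ∃ y ∈ t, ∃ z ∈ s, z ∉ t ∧ r y z := by
  by_contra! hcon
  refine hne (ht.antisymm fun z hz => ?_)
  have := hs x (ht hx) z hz
  induction this with
  | refl => exact hx
  | tail _ h ih => exact by_contra fun hc => hcon _ (ih h.2.1) _ h.2.2 hc h.1

/-- A finite linked set can be built up from any of its elements by adding adjacent elements one
at a time. -/
theorem IsLinked.induction_on (hs : IsLinked r s) (hfin : s.Finite) (hx : x ∈ s)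
    {Q : Set α → Prop} (h0 : Q {x})
    (h1 : ∀ S ⊆ s, Q S → ∀ y ∈ S, ∀ z ∈ s, z ∉ S → r y z → Q (insert z S)) : Q s := by
  have hfin' : {S : Set α | S ⊆ s ∧ x ∈ S ∧ Q S}.Finite :=
    hfin.finite_subsets.subset fun S hS => hS.1
  -- A maximal subset with the property must be everything, since otherwise linkedness supplies an
  -- adjacent element to add.
  obtain ⟨S, hS⟩ := hfin'.exists_maximal ⟨{x}, by simpa using hx, rfl, h0⟩
  by_contra hcon
  have hne : S ≠ s := fun h => hcon (h ▸ hS.prop.2.2)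
  obtain ⟨y, hy, z, hz, hzS, hyz⟩ := hs.exists_boundary hS.prop.1 hS.prop.2.1 hne
  have := hS.le_of_ge ⟨Set.insert_subset hz hS.prop.1, Set.mem_insert_of_mem _ hS.prop.2.1,
    h1 S hS.prop.1 hS.prop.2.2 y hy z hz hzS hyz⟩ (Set.subset_insert z S)
  exact hzS (this (Set.mem_insert z S))

theorem isLinked_setOf_joined (hr : ∀ a b, r a b → r b a) :
    IsLinked r {y | Joined r s x y} := by
  refine IsLinked.of_root hr (x := x) fun y hy => ?_
  induction hy with
  | refl => exact Relation.ReflTransGen.refl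
  | tail h h' ih => exact ih.trans (Joined.single h'.1 h (Relation.ReflTransGen.tail h h'))

end Connectivity

/-- Adjacency in the square grid. -/
def GridAdj (a b : ℤ × ℤ) : Prop :=
  (a.1 = b.1 ∧ (a.2 = b.2 + 1 ∨ b.2 = a.2 + 1)) ∨ (a.2 = b.2 ∧ (a.1 = b.1 + 1 ∨ b.1 = a.1 + 1))

theorem GridAdj.symm (a b : ℤ × ℤ) (h : GridAdj a b) : GridAdj b a := by
  unfold GridAdj at *; omega

theorem GridAdj.ne {a b : ℤ × ℤ} (h : GridAdj a b) : a ≠ b := by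
  rintro rfl; unfold GridAdj at h; omega

/-- `R` exhibits `G` as a minor of the square grid. -/
structure IsGridModel {V : Type*} (G : SimpleGraph V) (R : V → Set (ℤ × ℤ)) : Prop where
  finite : ∀ v, (R v).Finite
  nonempty : ∀ v, (R v).Nonempty
  linked : ∀ v, IsLinked GridAdj (R v)
  eq_of_mem : ∀ u v x, x ∈ R u → x ∈ R v → u = v
  exists_adj : ∀ u v, G.Adj u v → ∃ g ∈ R u, ∃ h ∈ R v, GridAdj g h

end CliqueHierarchy
-- From thick models to grid models
namespace CliqueHierarchy

theorem joined_setOf_joined {α : Type*} {r : α → α → Prop} {s : Set α} {x y : α}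
    (h : Joined r s x y) : Joined r {z | Joined r s x z} x y := by
  induction h with
  | refl => exact Relation.ReflTransGen.refl
  | tail h h' ih => exact ih.trans (Joined.single h'.1 h (Relation.ReflTransGen.tail h h'))

/-- A model in which the edges are represented by sets of their own, which are allowed to overlap
near common endpoints, can be turned into a grid model. -/
theorem exists_isGridModel_of_thick {V : Type*} [Finite V] {G : SimpleGraph V}
    {R₀ : V → Set (ℤ × ℤ)} {R₁ : Sym2 V → Set (ℤ × ℤ)}
    (hfin₀ : ∀ v, (R₀ v).Finite) (hfin₁ : ∀ e ∈ G.edgeSet, (R₁ e).Finite)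
    (hne : ∀ v, (R₀ v).Nonempty) (hl₀ : ∀ v, IsLinked GridAdj (R₀ v))
    (hl₁ : ∀ e ∈ G.edgeSet, IsLinked GridAdj (R₁ e))
    (hd₀ : ∀ u v x, x ∈ R₀ u → x ∈ R₀ v → u = v)
    (hmeet : ∀ e ∈ G.edgeSet, ∀ v ∈ e, (R₀ v ∩ R₁ e).Nonempty)
    (hd₁ : ∀ e ∈ G.edgeSet, ∀ v x, x ∈ R₀ v → x ∈ R₁ e → v ∈ e)
    (hd₂ : ∀ e ∈ G.edgeSet, ∀ f ∈ G.edgeSet, e ≠ f → ∀ x, x ∈ R₁ e → x ∈ R₁ f → ∃ v, x ∈ R₀ v) :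
    ∃ R, IsGridModel G R := by
  have hout : ∀ e : Sym2 V, ∃ p : V × V, e = s(p.1, p.2) := fun e =>
    Sym2.ind (fun a b => ⟨(a, b), rfl⟩) e
  choose o ho using hout
  have hoe : ∀ e ∈ G.edgeSet, G.Adj (o e).1 (o e).2 := fun e he => by
    rw [ho e] at he; exact he
  -- Each edge is oriented, and its first end absorbs the portion of the edge set reachable from
  -- that end before entering the part of the second end. A point shared by two such portions lies
  -- in a vertex part, which must be that of the first end of both edges.
  let D : Sym2 V → Set (ℤ × ℤ) := fun e =>
    {z | ∃ x ∈ R₀ (o e).1 ∩ R₁ e, Joined GridAdj (R₁ e \ R₀ (o e).2) x z}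
  have hD : ∀ e ∈ G.edgeSet, ∀ z ∈ D e, z ∈ R₁ e \ R₀ (o e).2 := by
    rintro e he z ⟨x, ⟨hx0, hx1⟩, hxz⟩
    exact hxz.mem_right ⟨hx1, fun h => (hoe e he).ne (hd₀ _ _ _ hx0 h)⟩
  have hDR : ∀ e ∈ G.edgeSet, ∀ z ∈ D e, ∀ u, z ∈ R₀ u → u = (o e).1 := by
    intro e he z hz u hzu
    have h := hD e he z hz
    have hue := hd₁ e he u z hzu h.1
    rw [ho e, Sym2.mem_iff] at hue
    exact hue.resolve_right fun h' => h.2 (h' ▸ hzu)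
  let R : V → Set (ℤ × ℤ) := fun u => R₀ u ∪ {z | ∃ e ∈ G.edgeSet, (o e).1 = u ∧ z ∈ D e}
  refine ⟨R, ⟨fun u => ?_, fun u => (hne u).mono Set.subset_union_left, fun u => ?_, ?_, ?_⟩⟩
  · refine (hfin₀ u).union ((Set.Finite.biUnion (Set.toFinite G.edgeSet) hfin₁).subset ?_)
    rintro z ⟨e, he, -, hz⟩
    exact Set.mem_biUnion he (hD e he z hz).1
  · obtain ⟨x₀, hx₀⟩ := hne u
    refine IsLinked.of_root GridAdj.symm (x := x₀) ?_
    rintro y (hy | ⟨e, he, rfl, x, hx, hxy⟩)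
    · exact (hl₀ u _ hx₀ y hy).mono Set.subset_union_left
    · refine ((hl₀ _ _ hx₀ x hx.1).mono Set.subset_union_left).trans
        ((joined_setOf_joined hxy).mono fun z hz => Or.inr ⟨e, he, rfl, x, hx, hz⟩)
  · rintro u v x (hu | ⟨e, he, rfl, hxe⟩) (hv | ⟨f, hf, rfl, hxf⟩)
    · exact hd₀ _ _ _ hu hv
    · exact hDR f hf x hxf u hu
    · exact (hDR e he x hxe v hv).symm
    · by_cases hef : e = f
      · rw [hef]
      · obtain ⟨w, hw⟩ := hd₂ e he f hf hef x (hD e he x hxe).1 (hD f hf x hxf).1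
        rw [← hDR e he x hxe w hw, ← hDR f hf x hxf w hw]
  · have key : ∀ e ∈ G.edgeSet, ∃ g ∈ R (o e).1, ∃ h ∈ R (o e).2, GridAdj g h := by
      intro e he
      obtain ⟨x, hx⟩ := hmeet e he (o e).1 (by
        have := Sym2.mem_mk_left (o e).1 (o e).2
        rwa [← ho e] at this)
      obtain ⟨y, hy⟩ := hmeet e he (o e).2 (by
        have := Sym2.mem_mk_right (o e).1 (o e).2
        rwa [← ho e] at this)
      have hxy := hl₁ e he x hx.2 y hy.2
      -- Following a chain along the edge set, the first step into the part of the second end yields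
      -- the required adjacency.
      have hor : ∀ z, Joined GridAdj (R₁ e) x z →
          z ∈ D e ∨ ∃ g ∈ D e, ∃ h ∈ R₀ (o e).2, GridAdj g h := by
        intro z hz
        induction hz with
        | refl => exact Or.inl ⟨x, hx, Relation.ReflTransGen.refl⟩
        | @tail b c _ h ih =>
          rcases ih with ih | ih
          · by_cases hc : c ∈ R₀ (o e).2
            · exact Or.inr ⟨b, ih, c, hc, h.1⟩
            · have hb := hD e he b ih
              obtain ⟨x', hx', hj⟩ := ih
              exact Or.inl ⟨x', hx', hj.trans (Joined.single h.1 hb ⟨h.2.2, hc⟩)⟩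
          · exact Or.inr ih
      rcases hor y hxy with h | ⟨g, hg, h, hh, hgh⟩
      · exact ((hD e he y h).2 hy.1).elim
      · exact ⟨g, Or.inr ⟨e, he, rfl, hg⟩, h, Or.inl hh, hgh⟩
    intro u v huv
    have he : s(u, v) ∈ G.edgeSet := huv
    obtain ⟨g, hg, h, hh, hgh⟩ := key _ he
    have hs := ho s(u, v)
    rw [Sym2.eq_iff] at hs
    rcases hs with ⟨h1, h2⟩ | ⟨h1, h2⟩
    · rw [← h1] at hg; rw [← h2] at hh; exact ⟨g, hg, h, hh, hgh⟩
    · rw [← h2] at hg; rw [← h1] at hh; exact ⟨h, hh, g, hg, GridAdj.symm _ _ hgh⟩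

/-! ### Pixelating a drawing -/

section Pixels

/-- The grid points within one step (also diagonally) of the pixel of a point of `S`, for pixels of
side length `ε`. -/
def pixels (ε : ℝ) (S : Set (EuclideanSpace ℝ (Fin 2))) : Set (ℤ × ℤ) :=
  {z | ∃ x ∈ S, |z.1 - ⌊x 0 / ε⌋| ≤ 1 ∧ |z.2 - ⌊x 1 / ε⌋| ≤ 1}

variable {ε : ℝ} {S T : Set (EuclideanSpace ℝ (Fin 2))}

theorem floor_mem_pixels {x : EuclideanSpace ℝ (Fin 2)} (hx : x ∈ S) :
    (⌊x 0 / ε⌋, ⌊x 1 / ε⌋) ∈ pixels ε S := ⟨x, hx, by simp, by simp⟩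

theorem joined_pixels {x : EuclideanSpace ℝ (Fin 2)} (hx : x ∈ S) {z : ℤ × ℤ}
    (h1 : |z.1 - ⌊x 0 / ε⌋| ≤ 1) (h2 : |z.2 - ⌊x 1 / ε⌋| ≤ 1) :
    Joined GridAdj (pixels ε S) (⌊x 0 / ε⌋, ⌊x 1 / ε⌋) z := by
  have step : ∀ a b : ℤ × ℤ, a ∈ pixels ε S → b ∈ pixels ε S → (a = b ∨ GridAdj a b) →
      Joined GridAdj (pixels ε S) a b := by
    rintro a b ha hb (rfl | h)
    · exact Relation.ReflTransGen.refl
    · exact Joined.single h ha hb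
  have hm : (z.1, ⌊x 1 / ε⌋) ∈ pixels ε S := ⟨x, hx, h1, by simp⟩
  rw [abs_le] at h1 h2
  refine (step _ _ (floor_mem_pixels hx) hm ?_).trans (step _ z hm ⟨x, hx, ?_, ?_⟩ ?_)
  · by_cases h : z.1 = ⌊x 0 / ε⌋
    · left; rw [h]
    · right; right; simp only [true_and]; omega
  · rw [abs_le]; exact h1
  · rw [abs_le]; exact h2
  · by_cases h : z.2 = ⌊x 1 / ε⌋
    · left; rw [← h]
    · right; left; simp only [true_and]; omega

/-- Nearby points have coordinate floors differing by at most 1, so the central pixel of one lies in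
the $3\times3$ block of the other. Connectedness of the set links all the blocks; admitting diagonal
neighbours is what makes this work with the four-neighbour adjacency. -/
theorem isLinked_pixels (hS : IsPreconnected S) : IsLinked GridAdj (pixels ε S) := by
  have hloc : ∀ (i : Fin 2) (x : EuclideanSpace ℝ (Fin 2)),
      ∀ᶠ y : EuclideanSpace ℝ (Fin 2) in nhds x, |⌊y i / ε⌋ - ⌊x i / ε⌋| ≤ 1 := by
    intro i x
    have hc : Continuous fun y : EuclideanSpace ℝ (Fin 2) => y i / ε := by fun_prop
    filter_upwards [hc.continuousAt.eventually (Metric.ball_mem_nhds (x i / ε) one_pos)] with y hy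
    rw [Real.dist_eq, abs_lt] at hy
    have a1 := Int.floor_le (y i / ε)
    have a2 := Int.lt_floor_add_one (y i / ε)
    have b1 := Int.floor_le (x i / ε)
    have b2 := Int.lt_floor_add_one (x i / ε)
    rw [abs_le]
    constructor
    · have : ((⌊x i / ε⌋ : ℤ) : ℝ) < ((⌊y i / ε⌋ + 2 : ℤ) : ℝ) := by push_cast; linarith
      have := Int.cast_lt.1 this
      omega
    · have : ((⌊y i / ε⌋ : ℤ) : ℝ) < ((⌊x i / ε⌋ + 2 : ℤ) : ℝ) := by push_cast; linarith
      have := Int.cast_lt.1 this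
      omega
  have key : ∀ x ∈ S, ∀ y ∈ S,
      Joined GridAdj (pixels ε S) (⌊x 0 / ε⌋, ⌊x 1 / ε⌋) (⌊y 0 / ε⌋, ⌊y 1 / ε⌋) := by
    intro x hx y hy
    refine hS.induction₂ (fun x y =>
      Joined GridAdj (pixels ε S) (⌊x 0 / ε⌋, ⌊x 1 / ε⌋) (⌊y 0 / ε⌋, ⌊y 1 / ε⌋))
      (fun x hx => ?_) (fun _ _ _ _ _ _ => Joined.trans) (fun _ _ _ _ => Joined.symm GridAdj.symm)
      hx hy
    filter_upwards [nhdsWithin_le_nhds (hloc 0 x), nhdsWithin_le_nhds (hloc 1 x)] with y h0 h1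
    exact joined_pixels hx h0 h1
  rintro a ⟨x, hx, hax⟩ b ⟨y, hy, hby⟩
  exact (((joined_pixels hx hax.1 hax.2).symm GridAdj.symm).trans (key x hx y hy)).trans
    (joined_pixels hy hby.1 hby.2)

theorem finite_pixels (hε : 0 < ε) (hS : Bornology.IsBounded S) : (pixels ε S).Finite := by
  obtain ⟨C, hC⟩ := hS.exists_norm_le
  have hb : ∀ (i : Fin 2), ∀ x ∈ S, |⌊x i / ε⌋| ≤ ⌈C / ε⌉ + 1 := by
    intro i x hx
    have h1 : |x i| ≤ C := (PiLp.norm_apply_le x i).trans (hC x hx)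
    have h2 : |x i / ε| ≤ C / ε := by rw [abs_div, abs_of_pos hε]; gcongr
    have h3 := Int.le_ceil (C / ε)
    have a1 := Int.floor_le (x i / ε)
    have a2 := Int.lt_floor_add_one (x i / ε)
    rw [abs_le] at h2 ⊢
    constructor
    · have : ((-(⌈C / ε⌉ + 1) : ℤ) : ℝ) ≤ ((⌊x i / ε⌋ : ℤ) : ℝ) := by push_cast; linarith
      exact Int.cast_le.1 this
    · have : ((⌊x i / ε⌋ : ℤ) : ℝ) ≤ ((⌈C / ε⌉ + 1 : ℤ) : ℝ) := by push_cast; linarith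
      exact Int.cast_le.1 this
  refine ((Set.finite_Icc (-(⌈C / ε⌉ + 2)) (⌈C / ε⌉ + 2)).prod
    (Set.finite_Icc (-(⌈C / ε⌉ + 2)) (⌈C / ε⌉ + 2))).subset ?_
  rintro z ⟨x, hx, h0, h1⟩
  have h0' := hb 0 x hx
  have h1' := hb 1 x hx
  rw [abs_le] at *
  refine ⟨⟨?_, ?_⟩, ⟨?_, ?_⟩⟩ <;> omega

/-- The two floors differ by at most 2 in each coordinate, hence the coordinates by at most
$3\varepsilon$; the constant 6 is generous for the Euclidean norm. -/
theorem dist_le_of_pixels (hε : 0 < ε) {z : ℤ × ℤ} {x y : EuclideanSpace ℝ (Fin 2)}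
    (hx : |z.1 - ⌊x 0 / ε⌋| ≤ 1 ∧ |z.2 - ⌊x 1 / ε⌋| ≤ 1)
    (hy : |z.1 - ⌊y 0 / ε⌋| ≤ 1 ∧ |z.2 - ⌊y 1 / ε⌋| ≤ 1) : dist x y ≤ 6 * ε := by
  have key : ∀ (n : ℤ) (a b : ℝ), |n - ⌊a / ε⌋| ≤ 1 → |n - ⌊b / ε⌋| ≤ 1 → |a - b| ≤ 3 * ε := by
    intro n a b ha hb
    have a1 := Int.floor_le (a / ε)
    have a2 := Int.lt_floor_add_one (a / ε)
    have b1 := Int.floor_le (b / ε)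
    have b2 := Int.lt_floor_add_one (b / ε)
    have ha' : |(n : ℝ) - ⌊a / ε⌋| ≤ 1 := by exact_mod_cast ha
    have hb' : |(n : ℝ) - ⌊b / ε⌋| ≤ 1 := by exact_mod_cast hb
    rw [abs_le] at ha' hb'
    have : |a / ε - b / ε| ≤ 3 := by rw [abs_le]; constructor <;> linarith
    rwa [← sub_div, abs_div, abs_of_pos hε, div_le_iff₀ hε] at this
  have h0 := key _ _ _ hx.1 hy.1
  have h1 := key _ _ _ hx.2 hy.2
  rw [EuclideanSpace.dist_eq, Fin.sum_univ_two, Real.dist_eq, Real.dist_eq]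
  refine Real.sqrt_le_iff.2 ⟨by positivity, ?_⟩
  have a0 := abs_nonneg (x 0 - y 0)
  have a1 := abs_nonneg (x 1 - y 1)
  nlinarith

theorem eventually_disjoint_pixels (hS : IsCompact S) (hT : IsClosed T) (hd : Disjoint S T) :
    ∀ᶠ ε in nhdsWithin (0 : ℝ) (Set.Ioi 0), Disjoint (pixels ε S) (pixels ε T) := by
  obtain ⟨δ, hδ, hdis⟩ := hd.exists_thickenings hS hT
  filter_upwards [Ioo_mem_nhdsGT (show (0 : ℝ) < δ / 6 by positivity)] with ε hε
  rw [Set.disjoint_left]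
  rintro z ⟨x, hx, hzx⟩ ⟨y, hy, hzy⟩
  have := dist_le_of_pixels hε.1 hzx hzy
  refine Set.disjoint_left.1 hdis (Metric.self_subset_thickening hδ _ hx)
    (Metric.mem_thickening_iff.2 ⟨y, hy, ?_⟩)
  have := hε.2
  linarith

end Pixels

theorem IsArc.exists_path {A : Set (EuclideanSpace ℝ (Fin 2))} {p q : EuclideanSpace ℝ (Fin 2)}
    (h : IsArc A p q) : IsCompact A ∧ IsPreconnected A ∧ p ∈ A ∧ q ∈ A := by
  obtain ⟨γ, -, rfl⟩ := h
  exact ⟨isCompact_range γ.continuous, isPreconnected_range γ.continuous, ⟨0, γ.source⟩,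
    ⟨1, γ.target⟩⟩

theorem PlaneEmbedding.arc_prop {V : Type*} {G : SimpleGraph V} (D : PlaneEmbedding G)
    {e : Sym2 V} (he : e ∈ G.edgeSet) :
    IsCompact (D.arc e) ∧ IsPreconnected (D.arc e) ∧ ∀ v ∈ e, D.point v ∈ D.arc e := by
  induction e using Sym2.ind with
  | _ u v =>
    obtain ⟨h1, h2, h3, h4⟩ := (D.isArc u v he).exists_path
    refine ⟨h1, h2, fun w hw => ?_⟩
    rcases Sym2.mem_iff.1 hw with rfl | rfl
    · exact h3
    · exact h4

/-- Every finite planar graph is a minor of the square grid. -/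
theorem IsPlanar.exists_isGridModel {V : Type*} [Finite V] {G : SimpleGraph V}
    (hG : IsPlanar G) : ∃ R, IsGridModel G R := by
  obtain ⟨D⟩ := hG
  -- Vertices become small discs, disjoint from one another and from all nonincident arcs.
  have hr : ∃ r : ℝ, 0 < r ∧
      (∀ u v, u ≠ v → Disjoint (Metric.closedBall (D.point u) r)
        (Metric.closedBall (D.point v) r)) ∧
      ∀ v, ∀ e, e ∈ G.edgeSet → v ∉ e → Disjoint (Metric.closedBall (D.point v) r) (D.arc e) := by
    have h1 : ∀ᶠ r in nhdsWithin (0 : ℝ) (Set.Ioi 0), ∀ u v, u ≠ v →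
        Disjoint (Metric.closedBall (D.point u) r) (Metric.closedBall (D.point v) r) := by
      rw [Filter.eventually_all]; intro u
      rw [Filter.eventually_all]; intro v
      by_cases huv : u = v
      · exact Filter.Eventually.of_forall fun _ h => (h huv).elim
      have hp : 0 < dist (D.point u) (D.point v) := dist_pos.2 (D.point_injective.ne huv)
      filter_upwards [Ioo_mem_nhdsGT (half_pos hp)] with r hr _
      exact Metric.closedBall_disjoint_closedBall (by have := hr.2; linarith)
    have h2 : ∀ᶠ r in nhdsWithin (0 : ℝ) (Set.Ioi 0), ∀ v, ∀ e, e ∈ G.edgeSet → v ∉ e →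
        Disjoint (Metric.closedBall (D.point v) r) (D.arc e) := by
      rw [Filter.eventually_all]; intro v
      rw [Filter.eventually_all]; intro e
      by_cases he : e ∈ G.edgeSet
      swap
      · exact Filter.Eventually.of_forall fun _ h => (he h).elim
      by_cases hv : v ∈ e
      · exact Filter.Eventually.of_forall fun _ _ h => (h hv).elim
      have hn : (D.arc e)ᶜ ∈ nhds (D.point v) :=
        (D.arc_prop he).1.isClosed.isOpen_compl.mem_nhds fun h => hv (D.vertex_on_arc e he v h)
      obtain ⟨δ, hδ, hs⟩ := Metric.nhds_basis_closedBall.mem_iff.1 hn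
      filter_upwards [Ioo_mem_nhdsGT hδ] with r hr _ _
      exact Set.disjoint_left.2 fun x hx => hs (Metric.closedBall_subset_closedBall hr.2.le hx)
    obtain ⟨r, h1, h2, h3⟩ := (h1.and (h2.and self_mem_nhdsWithin)).exists
    exact ⟨r, h3, h1, h2⟩
  obtain ⟨r, hr, hBB, hBA⟩ := hr
  set B : V → Set (EuclideanSpace ℝ (Fin 2)) := fun v => Metric.closedBall (D.point v) r with hB
  have hBc : ∀ v, IsCompact (B v) := fun v => isCompact_closedBall _ _
  have e1 : ∀ᶠ ε in nhdsWithin (0 : ℝ) (Set.Ioi 0), ∀ u v, u ≠ v →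
      Disjoint (pixels ε (B u)) (pixels ε (B v)) := by
    rw [Filter.eventually_all]; intro u
    rw [Filter.eventually_all]; intro v
    by_cases huv : u = v
    · exact Filter.Eventually.of_forall fun _ h => (h huv).elim
    filter_upwards [eventually_disjoint_pixels (hBc u) (hBc v).isClosed (hBB u v huv)] with ε h _
    exact h
  have e2 : ∀ᶠ ε in nhdsWithin (0 : ℝ) (Set.Ioi 0), ∀ v, ∀ e, e ∈ G.edgeSet → v ∉ e →
      Disjoint (pixels ε (B v)) (pixels ε (D.arc e)) := by
    rw [Filter.eventually_all]; intro v
    rw [Filter.eventually_all]; intro e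
    by_cases he : e ∈ G.edgeSet ∧ v ∉ e
    · filter_upwards [eventually_disjoint_pixels (hBc v) (D.arc_prop he.1).1.isClosed
        (hBA v e he.1 he.2)] with ε h _ _
      exact h
    · exact Filter.Eventually.of_forall fun _ h h' => (he ⟨h, h'⟩).elim
  -- Two arcs can meet only at a vertex, so once the open discs are removed from one arc it is a
  -- compact set disjoint from the other. Overlapping pixels of two edges therefore lie in the
  -- pixels of some disc.
  have e3 : ∀ᶠ ε in nhdsWithin (0 : ℝ) (Set.Ioi 0), ∀ e f, e ∈ G.edgeSet → f ∈ G.edgeSet → e ≠ f →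
      Disjoint (pixels ε (D.arc e \ ⋃ v, Metric.ball (D.point v) r)) (pixels ε (D.arc f)) := by
    rw [Filter.eventually_all]; intro e
    rw [Filter.eventually_all]; intro f
    by_cases hef : e ∈ G.edgeSet ∧ f ∈ G.edgeSet ∧ e ≠ f
    · have hc : IsCompact (D.arc e \ ⋃ v, Metric.ball (D.point v) r) :=
        (D.arc_prop hef.1).1.diff (isOpen_iUnion fun _ => Metric.isOpen_ball)
      filter_upwards [eventually_disjoint_pixels hc (D.arc_prop hef.2.1).1.isClosed
        (Set.disjoint_left.2 fun x hx hx' => by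
          obtain ⟨w, -, -, rfl⟩ := D.arc_inter_arc e hef.1 f hef.2.1 hef.2.2 x ⟨hx.1, hx'⟩
          exact hx.2 (Set.mem_iUnion.2 ⟨w, Metric.mem_ball_self hr⟩))] with ε h _ _ _
      exact h
    · exact Filter.Eventually.of_forall fun _ h h' h'' => (hef ⟨h, h', h''⟩).elim
  obtain ⟨ε, h1, h2, h3, hε⟩ := (e1.and (e2.and (e3.and self_mem_nhdsWithin))).exists
  have hε : 0 < ε := hε
  refine exists_isGridModel_of_thick (R₀ := fun v => pixels ε (B v))
    (R₁ := fun e => pixels ε (D.arc e)) (fun v => finite_pixels hε (hBc v).isBounded)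
    (fun e he => finite_pixels hε (D.arc_prop he).1.isBounded)
    (fun v => ⟨_, floor_mem_pixels (Metric.mem_closedBall_self hr.le)⟩)
    (fun v => isLinked_pixels (convex_closedBall _ _).isPreconnected)
    (fun e he => isLinked_pixels (D.arc_prop he).2.1) (fun u v x hu hv => ?_)
    (fun e he v hv => ⟨_, floor_mem_pixels (Metric.mem_closedBall_self hr.le),
      floor_mem_pixels ((D.arc_prop he).2.2 v hv)⟩) (fun e he v x hx hxe => ?_)
    fun e he f hf hef z hz hzf => ?_
  · by_contra huv
    exact Set.disjoint_left.1 (h1 u v huv) hu hv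
  · by_contra hv
    exact Set.disjoint_left.1 (h2 v e he hv) hx hxe
  · obtain ⟨x, hx, hzx⟩ := hz
    by_cases hxb : x ∈ ⋃ v, Metric.ball (D.point v) r
    · obtain ⟨v, hv⟩ := Set.mem_iUnion.1 hxb
      exact ⟨v, x, Metric.ball_subset_closedBall hv, hzx⟩
    · exact (Set.disjoint_left.1 (h3 e f he hf hef) ⟨x, ⟨hx, hxb⟩, hzx⟩ hzf).elim

end CliqueHierarchy
-- Geometry of grid segments
namespace CliqueHierarchy

/-- A grid point as a point of the plane. -/
def gridPoint (g : ℤ × ℤ) : ℝ × ℝ := (g.1, g.2)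

/-- The segment between two grid points. -/
def gridSeg (g h : ℤ × ℤ) : Set (ℝ × ℝ) := segment ℝ (gridPoint g) (gridPoint h)

theorem gridSeg_comm (g h : ℤ × ℤ) : gridSeg g h = gridSeg h g := segment_symm _ _ _

theorem gridPoint_injective : Function.Injective gridPoint := by
  rintro ⟨a, b⟩ ⟨c, d⟩ h
  simp only [gridPoint, Prod.mk.injEq, Int.cast_inj] at h
  exact Prod.ext h.1 h.2

theorem gridSeg_cases {g h : ℤ × ℤ} (hgh : GridAdj g h) {x : ℝ × ℝ} (hx : x ∈ gridSeg g h) :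
    (∃ a b : ℤ, ((g = (a, b) ∧ h = (a + 1, b)) ∨ (h = (a, b) ∧ g = (a + 1, b))) ∧
      x.2 = b ∧ (a : ℝ) ≤ x.1 ∧ x.1 ≤ a + 1) ∨
    (∃ a b : ℤ, ((g = (a, b) ∧ h = (a, b + 1)) ∨ (h = (a, b) ∧ g = (a, b + 1))) ∧
      x.1 = a ∧ (b : ℝ) ≤ x.2 ∧ x.2 ≤ b + 1) := by
  obtain ⟨g1, g2⟩ := g
  obtain ⟨h1, h2⟩ := h
  obtain ⟨s, t, hs, ht, hst, rfl⟩ := hx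
  obtain rfl : s = 1 - t := by linarith
  simp only [GridAdj] at hgh
  rcases hgh with ⟨rfl, rfl | rfl⟩ | ⟨rfl, rfl | rfl⟩
  · refine Or.inr ⟨g1, h2, Or.inr ⟨rfl, rfl⟩, ?_⟩
    simp [gridPoint]; constructor; ring; constructor <;> nlinarith
  · refine Or.inr ⟨g1, g2, Or.inl ⟨rfl, rfl⟩, ?_⟩
    simp [gridPoint]; constructor; ring; constructor <;> nlinarith
  · refine Or.inl ⟨h1, g2, Or.inr ⟨rfl, rfl⟩, ?_⟩
    simp [gridPoint]; constructor; ring; constructor <;> nlinarith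
  · refine Or.inl ⟨g1, g2, Or.inl ⟨rfl, rfl⟩, ?_⟩
    simp [gridPoint]; constructor; ring; constructor <;> nlinarith

/-- Two different edges of the grid meet only at common endpoints. -/
theorem gridSeg_inter {g h g' h' : ℤ × ℤ} (hgh : GridAdj g h) (hgh' : GridAdj g' h') {x : ℝ × ℝ}
    (hx : x ∈ gridSeg g h) (hx' : x ∈ gridSeg g' h') :
    ((g = g' ∧ h = h') ∨ (g = h' ∧ h = g')) ∨
      ∃ k, (k = g ∨ k = h) ∧ (k = g' ∨ k = h') ∧ x = gridPoint k := by
  rcases gridSeg_cases hgh hx with ⟨a, b, h1, e1, e2, e3⟩ | ⟨a, b, h1, e1, e2, e3⟩ <;>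
  rcases gridSeg_cases hgh' hx' with ⟨a', b', h1', e1', e2', e3'⟩ | ⟨a', b', h1', e1', e2', e3'⟩
  · obtain rfl : b = b' := by exact_mod_cast e1.symm.trans e1'
    have i1 : a ≤ a' + 1 := by exact_mod_cast e2.trans e3'
    have i2 : a' ≤ a + 1 := by exact_mod_cast e2'.trans e3
    obtain h | h | h : a = a' ∨ a = a' + 1 ∨ a' = a + 1 := by omega
    · subst h; left; rcases h1 with ⟨rfl, rfl⟩ | ⟨rfl, rfl⟩ <;>
        rcases h1' with ⟨rfl, rfl⟩ | ⟨rfl, rfl⟩ <;> simp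
    · subst h; right
      refine ⟨(a' + 1, b), by grind, by grind, ?_⟩
      push_cast at e2
      ext
      · simp only [gridPoint]; push_cast; linarith
      · exact e1
    · subst h; right
      refine ⟨(a + 1, b), by grind, by grind, ?_⟩
      push_cast at e2'
      ext
      · simp only [gridPoint]; push_cast; linarith
      · exact e1
  · rw [e1] at e2' e3'; rw [e1'] at e2 e3
    right
    refine ⟨(a', b), ?_, ?_, ?_⟩
    · have i1 : a ≤ a' := by exact_mod_cast e2
      have i2 : a' ≤ a + 1 := by exact_mod_cast e3
      obtain rfl | rfl : a' = a ∨ a' = a + 1 := by omega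
      all_goals grind
    · have i1 : b' ≤ b := by exact_mod_cast e2'
      have i2 : b ≤ b' + 1 := by exact_mod_cast e3'
      obtain rfl | rfl : b = b' ∨ b = b' + 1 := by omega
      all_goals grind
    · ext
      · exact e1'
      · exact e1
  · rw [e1] at e2' e3'; rw [e1'] at e2 e3
    right
    refine ⟨(a, b'), ?_, ?_, ?_⟩
    · have i1 : b ≤ b' := by exact_mod_cast e2
      have i2 : b' ≤ b + 1 := by exact_mod_cast e3
      obtain rfl | rfl : b' = b ∨ b' = b + 1 := by omega
      all_goals grind
    · have i1 : a' ≤ a := by exact_mod_cast e2'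
      have i2 : a ≤ a' + 1 := by exact_mod_cast e3'
      obtain rfl | rfl : a = a' ∨ a = a' + 1 := by omega
      all_goals grind
    · ext
      · exact e1
      · exact e1'
  · obtain rfl : a = a' := by exact_mod_cast e1.symm.trans e1'
    have i1 : b ≤ b' + 1 := by exact_mod_cast e2.trans e3'
    have i2 : b' ≤ b + 1 := by exact_mod_cast e2'.trans e3
    obtain h | h | h : b = b' ∨ b = b' + 1 ∨ b' = b + 1 := by omega
    · subst h; left; rcases h1 with ⟨rfl, rfl⟩ | ⟨rfl, rfl⟩ <;>
        rcases h1' with ⟨rfl, rfl⟩ | ⟨rfl, rfl⟩ <;> simp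
    · subst h; right
      refine ⟨(a, b' + 1), by grind, by grind, ?_⟩
      push_cast at e2
      ext
      · exact e1
      · simp only [gridPoint]; push_cast; linarith
    · subst h; right
      refine ⟨(a, b + 1), by grind, by grind, ?_⟩
      push_cast at e2'
      ext
      · exact e1
      · simp only [gridPoint]; push_cast; linarith

theorem one_le_abs_sub_of_lt {a b : ℤ} (hab : a < b) {x y : ℝ} (hx : x ≤ a) (hy : b ≤ y) :
    1 ≤ |x - y| := by
  have : ((a + 1 : ℤ) : ℝ) ≤ b := by exact_mod_cast hab
  push_cast at this
  rw [abs_sub_comm]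
  exact le_trans (by linarith) (le_abs_self _)

/-- The unit gap exceeds the reach $1/2$ of `collapse`, so collapsing a grid edge fixes every grid
edge disjoint from it. -/
theorem one_le_dist_gridSeg {g h g' h' : ℤ × ℤ} (hgh : GridAdj g h) (hgh' : GridAdj g' h')
    (h1 : g ≠ g') (h2 : g ≠ h') (h3 : h ≠ g') (h4 : h ≠ h') {x x' : ℝ × ℝ}
    (hx : x ∈ gridSeg g h) (hx' : x' ∈ gridSeg g' h') : 1 ≤ dist x x' := by
  rw [Prod.dist_eq, le_max_iff, Real.dist_eq, Real.dist_eq]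
  have low : ∀ {a b : ℤ} {x y : ℝ}, a < b → x ≤ a → b ≤ y → 1 ≤ |x - y| :=
    fun h a b => one_le_abs_sub_of_lt h a b
  have high : ∀ {a b : ℤ} {x y : ℝ}, b < a → (a : ℝ) ≤ x → y ≤ b → 1 ≤ |x - y| :=
    fun h a b => by rw [abs_sub_comm]; exact one_le_abs_sub_of_lt h b a
  have c1 : ∀ a : ℤ, (a : ℝ) + 1 = ((a + 1 : ℤ) : ℝ) := fun a => by push_cast; ring
  rcases gridSeg_cases hgh hx with ⟨a, b, k1, e1, e2, e3⟩ | ⟨a, b, k1, e1, e2, e3⟩ <;>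
  rcases gridSeg_cases hgh' hx' with ⟨a', b', k1', e1', e2', e3'⟩ | ⟨a', b', k1', e1', e2', e3'⟩ <;>
  rw [c1] at e3 e3'
  · obtain h | h | h | h : b < b' ∨ b' < b ∨ a + 1 < a' ∨ a' + 1 < a := by
      simp only [Prod.ext_iff, ne_eq] at *; omega
    · exact Or.inr (low h e1.le e1'.ge)
    · exact Or.inr (high h e1.ge e1'.le)
    · exact Or.inl (low h e3 e2')
    · exact Or.inl (high h e2 e3')
  · obtain h | h | h | h : b < b' ∨ b' + 1 < b ∨ a + 1 < a' ∨ a' < a := by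
      simp only [Prod.ext_iff, ne_eq] at *; omega
    · exact Or.inr (low h e1.le e2')
    · exact Or.inr (high h e1.ge e3')
    · exact Or.inl (low h e3 e1'.ge)
    · exact Or.inl (high h e2 e1'.le)
  · obtain h | h | h | h : b + 1 < b' ∨ b' < b ∨ a < a' ∨ a' + 1 < a := by
      simp only [Prod.ext_iff, ne_eq] at *; omega
    · exact Or.inr (low h e3 e1'.ge)
    · exact Or.inr (high h e2 e1'.le)
    · exact Or.inl (low h e1.le e2')
    · exact Or.inl (high h e1.ge e3')
  · obtain h | h | h | h : b + 1 < b' ∨ b' + 1 < b ∨ a < a' ∨ a' < a := by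
      simp only [Prod.ext_iff, ne_eq] at *; omega
    · exact Or.inr (low h e3 e2')
    · exact Or.inr (high h e2 e3')
    · exact Or.inl (low h e1.le e1'.ge)
    · exact Or.inl (high h e1.ge e1'.le)

theorem one_le_dist_gridPoint {g g' h' : ℤ × ℤ} (hgh' : GridAdj g' h')
    (h1 : g ≠ g') (h2 : g ≠ h') {x' : ℝ × ℝ} (hx' : x' ∈ gridSeg g' h') :
    1 ≤ dist (gridPoint g) x' := by
  rw [Prod.dist_eq, le_max_iff, Real.dist_eq, Real.dist_eq]
  have low : ∀ {a b : ℤ} {y : ℝ}, a < b → b ≤ y → 1 ≤ |(a : ℝ) - y| :=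
    fun h b => one_le_abs_sub_of_lt h le_rfl b
  have high : ∀ {a b : ℤ} {y : ℝ}, b < a → y ≤ b → 1 ≤ |(a : ℝ) - y| :=
    fun h b => by rw [abs_sub_comm]; exact one_le_abs_sub_of_lt h b le_rfl
  have c1 : ∀ a : ℤ, (a : ℝ) + 1 = ((a + 1 : ℤ) : ℝ) := fun a => by push_cast; ring
  obtain ⟨a, b⟩ := g
  rcases gridSeg_cases hgh' hx' with ⟨a', b', k1', e1', e2', e3'⟩ | ⟨a', b', k1', e1', e2', e3'⟩ <;>
  rw [c1] at e3'
  · obtain h | h | h | h : b < b' ∨ b' < b ∨ a < a' ∨ a' + 1 < a := by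
      simp only [Prod.ext_iff, ne_eq] at *; omega
    · exact Or.inr (low h e1'.ge)
    · exact Or.inr (high h e1'.le)
    · exact Or.inl (low h e2')
    · exact Or.inl (high h e3')
  · obtain h | h | h | h : b < b' ∨ b' + 1 < b ∨ a < a' ∨ a' < a := by
      simp only [Prod.ext_iff, ne_eq] at *; omega
    · exact Or.inr (low h e2')
    · exact Or.inr (high h e3')
    · exact Or.inl (low h e1'.ge)
    · exact Or.inl (high h e1'.le)

/-! ### Collapsing a convex set to a point -/

section Collapse
variable {E : Type*} [NormedAddCommGroup E] {K A : Set E} {y p q : E}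

theorem collapse_factor_nonneg : 0 ≤ min 1 (2 * Metric.infDist p K) :=
  le_min zero_le_one (mul_nonneg zero_le_two Metric.infDist_nonneg)

theorem mem_of_factor_eq_zero (hK : IsClosed K) (hy : y ∈ K)
    (h : min 1 (2 * Metric.infDist p K) = 0) : p ∈ K := by
  rw [hK.mem_iff_infDist_zero ⟨y, hy⟩]
  rcases min_choice 1 (2 * Metric.infDist p K) with h' | h' <;> rw [h'] at h <;> linarith

variable [NormedSpace ℝ E]

/-- The map of the space which collapses a convex set `K` to its point `y`, moves points towards
`y` and fixes all points at distance at least `1/2` from `K`. -/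
noncomputable def collapse (y : E) (K : Set E) (p : E) : E :=
  y + min 1 (2 * Metric.infDist p K) • (p - y)

theorem continuous_collapse : Continuous (collapse y K) := by
  have := Metric.continuous_infDist_pt K
  unfold collapse
  fun_prop

theorem collapse_eq_self (h : 1 ≤ 2 * Metric.infDist p K) : collapse y K p = p := by
  simp [collapse, min_eq_left h]

theorem collapse_of_mem (hp : p ∈ K) : collapse y K p = y := by
  simp [collapse, Metric.infDist_zero_of_mem hp]

theorem collapse_self : collapse y K y = y := by simp [collapse]

theorem collapse_mem (hA : Convex ℝ A) (hy : y ∈ A) (hp : p ∈ A) : collapse y K p ∈ A :=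
  hA.add_smul_sub_mem hy hp ⟨collapse_factor_nonneg, min_le_left _ _⟩

theorem mem_of_collapse_eq (hK : IsClosed K) (hy : y ∈ K) (h : collapse y K p = y) : p ∈ K := by
  rw [collapse, add_eq_left, smul_eq_zero] at h
  rcases h with h | h
  · exact mem_of_factor_eq_zero hK hy h
  · rwa [sub_eq_zero.1 h]

/-- Shrinking towards $y$ maps the convex set into itself and does not increase distances.
Consequently the scaling factor of `collapse` is monotone along rays from $y$. -/
theorem infDist_ray_le (hc : Convex ℝ K) (hy : y ∈ K) {t : ℝ} (h0 : 0 ≤ t) (h1 : t ≤ 1) :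
    Metric.infDist (y + t • (p - y)) K ≤ Metric.infDist p K := by
  rw [Metric.le_infDist ⟨y, hy⟩]
  intro k hk
  refine (Metric.infDist_le_dist_of_mem (hc.add_smul_sub_mem hy hk ⟨h0, h1⟩)).trans ?_
  rw [dist_add_left, dist_eq_norm, ← smul_sub, norm_smul, Real.norm_of_nonneg h0, dist_eq_norm,
    sub_sub_sub_cancel_right]
  exact mul_le_of_le_one_left (norm_nonneg _) h1

/-- Points with the same image lie on one ray from $y$. The point with the larger factor is the one
nearer to $y$, where monotonicity makes the factor no larger; so the factors, and then the points,
agree. -/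
theorem collapse_injOn (hc : Convex ℝ K) (hK : IsClosed K) (hy : y ∈ K)
    (h : collapse y K p = collapse y K q) (hp : p ∉ K) : p = q := by
  have hq : q ∉ K := fun hq => hp (mem_of_collapse_eq hK hy (h.trans (collapse_of_mem hq)))
  have key : ∀ p q : E, p ∉ K → q ∉ K → collapse y K p = collapse y K q →
      min 1 (2 * Metric.infDist p K) ≤ min 1 (2 * Metric.infDist q K) → p = q := by
    intro p q hp hq h hle
    have hq0 : 0 < min 1 (2 * Metric.infDist q K) :=
      lt_of_le_of_ne collapse_factor_nonneg fun h' => hq (mem_of_factor_eq_zero hK hy h'.symm)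
    have hp0 : 0 < min 1 (2 * Metric.infDist p K) :=
      lt_of_le_of_ne collapse_factor_nonneg fun h' => hp (mem_of_factor_eq_zero hK hy h'.symm)
    rw [collapse, collapse, add_right_inj] at h
    set a := min 1 (2 * Metric.infDist p K) with ha
    set b := min 1 (2 * Metric.infDist q K) with hb
    have hq' : q = y + (a / b) • (p - y) := by
      rw [div_eq_inv_mul, mul_smul, h, smul_smul, inv_mul_cancel₀ hq0.ne', one_smul]
      abel
    have hab : b ≤ a := by
      have := infDist_ray_le (p := p) hc hy (div_nonneg hp0.le hq0.le) ((div_le_one hq0).2 hle)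
      rw [← hq'] at this
      exact min_le_min le_rfl (by linarith)
    have hab : a = b := le_antisymm hle hab
    rw [hq', hab, div_self hq0.ne', one_smul]
    abel
  rcases le_total (min 1 (2 * Metric.infDist p K)) (min 1 (2 * Metric.infDist q K)) with h' | h'
  · exact key p q hp hq h h'
  · exact (key q p hq hp h.symm h').symm

end Collapse

theorem isClosed_gridSeg (g h : ℤ × ℤ) : IsClosed (gridSeg g h) := by
  unfold gridSeg
  rw [segment_eq_image_lineMap]
  exact (isCompact_Icc.image (by fun_prop)).isClosed

theorem one_le_two_mul_infDist {y l : ℤ × ℤ} {p : ℝ × ℝ} (h : ∀ k ∈ gridSeg y l, 1 ≤ dist p k) :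
    1 ≤ 2 * Metric.infDist p (gridSeg y l) := by
  have := (Metric.le_infDist (x := p) (r := 1) ⟨_, left_mem_segment ℝ (gridPoint y) (gridPoint l)⟩).2 h
  unfold gridSeg
  linarith

theorem collapse_gridPoint {y l g : ℤ × ℤ} (hyl : GridAdj y l) (hgl : g ≠ l) :
    collapse (gridPoint y) (gridSeg y l) (gridPoint g) = gridPoint g := by
  by_cases hgy : g = y
  · rw [hgy, collapse_self]
  · exact collapse_eq_self (one_le_two_mul_infDist fun k hk => one_le_dist_gridPoint hyl hgy hgl hk)

theorem collapse_eq_gridPoint {y l g : ℤ × ℤ} (hyl : GridAdj y l) (hgl : g ≠ l) {p : ℝ × ℝ}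
    (h : collapse (gridPoint y) (gridSeg y l) p = gridPoint g) :
    p = gridPoint g ∨ (p ∈ gridSeg y l ∧ g = y) := by
  by_cases hp : p ∈ gridSeg y l
  · rw [collapse_of_mem hp] at h
    exact Or.inr ⟨hp, (gridPoint_injective h).symm⟩
  · rw [← collapse_gridPoint hyl hgl] at h
    exact Or.inl (collapse_injOn (convex_segment _ _) (isClosed_gridSeg _ _)
      (left_mem_segment _ _ _) h hp)

theorem gridPoint_sub {y h : ℤ × ℤ} (hyh : GridAdj y h) :
    gridPoint h - gridPoint y = (1, 0) ∨ gridPoint h - gridPoint y = (-1, 0) ∨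
    gridPoint h - gridPoint y = (0, 1) ∨ gridPoint h - gridPoint y = (0, -1) := by
  obtain ⟨y1, y2⟩ := y
  obtain ⟨h1, h2⟩ := h
  simp only [GridAdj] at hyh
  rcases hyh with ⟨rfl, rfl | rfl⟩ | ⟨rfl, rfl | rfl⟩ <;> simp [gridPoint]

/-- Distinct directions at $y$ are opposite or perpendicular, so in the supremum metric leaving $y$
along one of them gains distance from the other at unit rate. -/
theorem le_dist_of_gridAdj {y l h : ℤ × ℤ} (hyl : GridAdj y l) (hyh : GridAdj y h) (hhl : h ≠ l)
    {s : ℝ} (hs : 0 ≤ s) {k : ℝ × ℝ} (hk : k ∈ gridSeg y l) :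
    s ≤ dist (gridPoint y + s • (gridPoint h - gridPoint y)) k := by
  rw [gridSeg, segment_eq_image'] at hk
  obtain ⟨t, ⟨ht0, ht1⟩, rfl⟩ := hk
  have hne : gridPoint h - gridPoint y ≠ gridPoint l - gridPoint y := fun e =>
    hhl (gridPoint_injective (sub_left_injective e))
  simp only [dist_add_left]
  rw [Prod.dist_eq, le_max_iff, Real.dist_eq, Real.dist_eq]
  rcases gridPoint_sub hyh with e | e | e | e <;> rcases gridPoint_sub hyl with e' | e' | e' | e' <;>
    rw [e, e'] at hne ⊢ <;> first | exact (hne rfl).elim | skip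
  all_goals
    simp only [Prod.smul_mk, smul_eq_mul, mul_one, mul_zero, mul_neg, sub_zero, zero_sub, neg_neg,
      abs_neg, abs_of_nonneg hs, le_refl, true_or, or_true]
  all_goals
    first
    | exact Or.inl (le_abs.2 (by first | left; linarith | right; linarith))
    | exact Or.inr (le_abs.2 (by first | left; linarith | right; linarith))

/-- Off the collapsed edge the map acts along rays from $y$, so the preimage lies on the ray through
$h$. It cannot lie beyond $h$, since such points have distance at least 1 from the collapsed edge
and are fixed. -/
theorem mem_of_collapse_mem_gridSeg_left {y l h : ℤ × ℤ} (hyl : GridAdj y l) (hyh : GridAdj y h)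
    (hhl : h ≠ l) {p : ℝ × ℝ} (hp : collapse (gridPoint y) (gridSeg y l) p ∈ gridSeg y h) :
    p ∈ gridSeg y h ∨ p ∈ gridSeg y l := by
  set c := min 1 (2 * Metric.infDist p (gridSeg y l)) with hc
  by_cases hc0 : c = 0
  · exact Or.inr (mem_of_factor_eq_zero (isClosed_gridSeg _ _) (left_mem_segment ℝ _ _) hc0)
  have hc0 : 0 < c := lt_of_le_of_ne collapse_factor_nonneg (Ne.symm hc0)
  left
  rw [gridSeg, segment_eq_image'] at hp
  obtain ⟨t, ⟨ht0, ht1⟩, ht⟩ := hp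
  rw [collapse, ← hc] at ht
  simp only [add_right_inj] at ht
  have hp : p = gridPoint y + (t / c) • (gridPoint h - gridPoint y) := by
    rw [div_eq_inv_mul, mul_smul, ht, smul_smul, inv_mul_cancel₀ hc0.ne', one_smul]
    abel
  have hs0 : 0 ≤ t / c := div_nonneg ht0 hc0.le
  have hs1 : t / c ≤ 1 := by
    by_contra! hlt
    have hc1 : c = 1 := min_eq_left (one_le_two_mul_infDist fun k hk => by
      have := le_dist_of_gridAdj hyl hyh hhl hs0 hk
      rw [← hp] at this
      exact hlt.le.trans this)
    rw [hc1, div_one] at hlt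
    linarith
  rw [hp, gridSeg, segment_eq_image']
  exact ⟨_, ⟨hs0, hs1⟩, rfl⟩

theorem collapse_mem_gridSeg {y l g h : ℤ × ℤ} (hyl : GridAdj y l) (hgh : GridAdj g h)
    (hgl : g ≠ l) (hhl : h ≠ l) {p : ℝ × ℝ} (hp : p ∈ gridSeg g h) :
    collapse (gridPoint y) (gridSeg y l) p ∈ gridSeg g h := by
  by_cases hgy : g = y
  · subst hgy; exact collapse_mem (convex_segment _ _) (left_mem_segment _ _ _) hp
  by_cases hhy : h = y
  · subst hhy; exact collapse_mem (convex_segment _ _) (right_mem_segment _ _ _) hp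
  rwa [collapse_eq_self (one_le_two_mul_infDist fun k hk =>
    one_le_dist_gridSeg hgh hyl hgy hgl hhy hhl hp hk)]

theorem mem_of_collapse_mem_gridSeg {y l g h : ℤ × ℤ} (hyl : GridAdj y l) (hgh : GridAdj g h)
    (hgl : g ≠ l) (hhl : h ≠ l) {p : ℝ × ℝ}
    (hp : collapse (gridPoint y) (gridSeg y l) p ∈ gridSeg g h) :
    p ∈ gridSeg g h ∨ (p ∈ gridSeg y l ∧ (g = y ∨ h = y)) := by
  by_cases hgy : g = y
  · subst hgy
    exact (mem_of_collapse_mem_gridSeg_left hyl hgh hhl hp).imp_right fun h => ⟨h, Or.inl rfl⟩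
  by_cases hhy : h = y
  · subst hhy
    rw [gridSeg_comm g] at hp ⊢
    exact (mem_of_collapse_mem_gridSeg_left hyl (GridAdj.symm _ _ hgh) hgl hp).imp_right
      fun h => ⟨h, Or.inr rfl⟩
  have hd : ∀ k ∈ gridSeg y l, 1 ≤ dist (collapse (gridPoint y) (gridSeg y l) p) k := fun k hk =>
    one_le_dist_gridSeg hgh hyl hgy hgl hhy hhl hp hk
  have hn : collapse (gridPoint y) (gridSeg y l) p ∉ gridSeg y l := fun h => by
    have := hd _ h
    rw [dist_self] at this
    linarith
  left
  have : collapse (gridPoint y) (gridSeg y l) p = p :=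
    collapse_injOn (convex_segment _ _) (isClosed_gridSeg _ _) (left_mem_segment ℝ _ _)
    (collapse_eq_self (one_le_two_mul_infDist hd)) hn
  rwa [this] at hp

end CliqueHierarchy
-- Drawing grid minors by collapsing trees
namespace CliqueHierarchy

/-- There is a continuous map of the plane to itself whose only nontrivial fibres are disjoint
unions of grid segments `T v` which contain the grid points in `R v`. -/
def IsCollapsible {V : Type*} (R : V → Set (ℤ × ℤ)) : Prop :=
  ∃ (F : ℝ × ℝ → ℝ × ℝ) (T : V → Set (ℝ × ℝ)), Continuous F ∧
    (∀ v, ∀ g ∈ R v, gridPoint g ∈ T v) ∧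
    (∀ v, ∀ x ∈ T v, (∃ g ∈ R v, x = gridPoint g) ∨
      ∃ g ∈ R v, ∃ h ∈ R v, GridAdj g h ∧ x ∈ gridSeg g h ∧ gridSeg g h ⊆ T v) ∧
    ∀ p q, F p = F q ↔ p = q ∨ ∃ v, p ∈ T v ∧ q ∈ T v

variable {V : Type*}

theorem isCollapsible_singleton (ρ : V → ℤ × ℤ) : IsCollapsible fun v => {ρ v} := by
  refine ⟨id, fun v => {gridPoint (ρ v)}, continuous_id, ?_, ?_, fun p q => ?_⟩
  · rintro v g rfl; rfl
  · rintro v x rfl; exact Or.inl ⟨_, rfl, rfl⟩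
  · refine ⟨Or.inl, ?_⟩
    rintro (h | ⟨v, rfl, rfl⟩)
    · exact h
    · rfl

/-- The new leaf edge is collapsed to its old end before the previous map is applied. This
precomposition respects the existing trees, because their vertices avoid the leaf: it maps each tree
into itself and pulls nothing back into it except the collapsed edge. -/
theorem IsCollapsible.insert_leaf [DecidableEq V] {R : V → Set (ℤ × ℤ)} (hR : IsCollapsible R)
    (hd : ∀ u v x, x ∈ R u → x ∈ R v → u = v) {v : V} {y l : ℤ × ℤ} (hy : y ∈ R v)
    (hyl : GridAdj y l) (hl : ∀ u, l ∉ R u) :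
    IsCollapsible (Function.update R v (insert l (R v))) := by
  obtain ⟨F, T, hF, hRT, hT, hfib⟩ := hR
  have hne : ∀ u, ∀ g ∈ R u, g ≠ l := fun u g hg h => hl u (h ▸ hg)
  set φ := collapse (gridPoint y) (gridSeg y l) with hφ
  have hyK : gridPoint y ∈ gridSeg y l := left_mem_segment ℝ _ _
  have f1 : ∀ u, ∀ p ∈ T u, φ p ∈ T u := by
    intro u p hp
    rcases hT u p hp with ⟨g, hg, rfl⟩ | ⟨g, hg, h, hh, hgh, hx, hs⟩
    · rw [hφ, collapse_gridPoint hyl (hne u g hg)]; exact hp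
    · exact hs (collapse_mem_gridSeg hyl hgh (hne u g hg) (hne u h hh) hx)
  have f2 : ∀ u p, φ p ∈ T u → p ∈ T u ∨ (p ∈ gridSeg y l ∧ u = v) := by
    intro u p hp
    rcases hT u _ hp with ⟨g, hg, he⟩ | ⟨g, hg, h, hh, hgh, hx, hs⟩
    · rcases collapse_eq_gridPoint hyl (hne u g hg) he with rfl | ⟨h, rfl⟩
      · exact Or.inl (hRT u g hg)
      · exact Or.inr ⟨h, hd _ _ _ hg hy⟩
    · rcases mem_of_collapse_mem_gridSeg hyl hgh (hne u g hg) (hne u h hh) hx with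
        h' | ⟨h', rfl | rfl⟩
      · exact Or.inl (hs h')
      · exact Or.inr ⟨h', hd _ _ _ hg hy⟩
      · exact Or.inr ⟨h', hd _ _ _ hh hy⟩
  refine ⟨F ∘ φ, Function.update T v (T v ∪ gridSeg y l), hF.comp continuous_collapse, ?_, ?_, ?_⟩
  · intro u g hg
    by_cases huv : u = v
    · subst huv
      simp only [Function.update_self] at hg ⊢
      rcases hg with rfl | hg
      · exact Or.inr (right_mem_segment _ _ _)
      · exact Or.inl (hRT u g hg)
    · simp only [Function.update_of_ne huv] at hg ⊢
      exact hRT u g hg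
  · intro u x hx
    by_cases huv : u = v
    · subst huv
      simp only [Function.update_self] at hx ⊢
      rcases hx with hx | hx
      · rcases hT u x hx with ⟨g, hg, he⟩ | ⟨g, hg, h, hh, hgh, hx, hs⟩
        · exact Or.inl ⟨g, Or.inr hg, he⟩
        · exact Or.inr ⟨g, Or.inr hg, h, Or.inr hh, hgh, hx, hs.trans Set.subset_union_left⟩
      · exact Or.inr ⟨y, Or.inr hy, l, Or.inl rfl, hyl, hx, Set.subset_union_right⟩
    · simp only [Function.update_of_ne huv] at hx ⊢
      exact hT u x hx
  · intro p q
    have hT' : ∀ u p, p ∈ Function.update T v (T v ∪ gridSeg y l) u ↔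
        p ∈ T u ∨ (p ∈ gridSeg y l ∧ u = v) := by
      intro u p
      by_cases huv : u = v
      · subst huv; simp
      · simp [huv]
    simp only [hT', Function.comp_apply, hfib]
    constructor
    · rintro (h | ⟨u, hp, hq⟩)
      · by_cases hp : p ∈ gridSeg y l
        · right
          rw [hφ, collapse_of_mem hp] at h
          exact ⟨v, Or.inr ⟨hp, rfl⟩,
            Or.inr ⟨mem_of_collapse_eq (isClosed_gridSeg _ _) hyK h.symm, rfl⟩⟩
        · exact Or.inl (collapse_injOn (convex_segment _ _) (isClosed_gridSeg _ _) hyK h hp)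
      · exact Or.inr ⟨u, f2 u p hp, f2 u q hq⟩
    · have f3 : ∀ u p, p ∈ T u ∨ (p ∈ gridSeg y l ∧ u = v) → φ p ∈ T u := by
        rintro u p (h | ⟨h, rfl⟩)
        · exact f1 u p h
        · rw [hφ, collapse_of_mem h]; exact hRT _ _ hy
      rintro (rfl | ⟨u, hp, hq⟩)
      · exact Or.inl rfl
      · exact Or.inr ⟨u, f3 u p hp, f3 u q hq⟩

/-- Starting from one root in each part, where the identity works, the parts are grown one after
another by adding leaves. Only the edges of the resulting spanning trees are collapsed. -/
theorem isCollapsible_of_isLinked [Finite V] {R : V → Set (ℤ × ℤ)} (hfin : ∀ v, (R v).Finite)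
    (hne : ∀ v, (R v).Nonempty) (hl : ∀ v, IsLinked GridAdj (R v))
    (hd : ∀ u v x, x ∈ R u → x ∈ R v → u = v) : IsCollapsible R := by
  classical
  choose ρ hρ using hne
  have := Fintype.ofFinite V
  have key : ∀ W : Finset V, IsCollapsible fun v => if v ∈ W then R v else {ρ v} := by
    intro W
    induction W using Finset.induction_on with
    | empty => simpa using isCollapsible_singleton ρ
    | insert v W hv ih =>
      set R' : V → Set (ℤ × ℤ) := fun v => if v ∈ W then R v else {ρ v} with hR'
      have hR'R : ∀ u, R' u ⊆ R u := by
        intro u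
        simp only [hR']
        split_ifs
        · exact subset_rfl
        · simpa using hρ u
      have heq : (fun u => if u ∈ insert v W then R u else {ρ u}) =
          Function.update R' v (R v) := by
        funext u
        by_cases huv : u = v
        · subst huv; simp
        · simp [huv, hR']
      rw [heq]
      refine (hl v).induction_on (hfin v) (hρ v)
        (Q := fun S => IsCollapsible (Function.update R' v S)) ?_ ?_
      · convert ih
        rw [Function.update_eq_self_iff]
        simp [hR', hv]
      · intro S hS hQ y hy z hz hzS hyz
        have hsub : ∀ u, Function.update R' v S u ⊆ R u := by
          intro u
          by_cases huv : u = v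
          · subst huv; simpa using hS
          · rw [Function.update_of_ne huv]; exact hR'R u
        have := hQ.insert_leaf (fun u w x hu hw => hd u w x (hsub u hu) (hsub w hw)) (v := v)
          (by simpa using hy) hyz fun u hu => by
            have huv := hd u v z (hsub u hu) hz
            subst huv
            exact hzS (by simpa using hu)
        simpa using this
  simpa using key Finset.univ

/-- The plane with the supremum metric is homeomorphic to the Euclidean plane. -/
noncomputable def planeHomeomorph : ℝ × ℝ ≃ₜ EuclideanSpace ℝ (Fin 2) :=
  (Homeomorph.finTwoArrow (X := ℝ)).symm.trans (PiLp.homeomorph 2 fun _ : Fin 2 => ℝ).symm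

/-- Every minor of the square grid is planar. -/
theorem IsGridModel.isPlanar [Finite V] {G : SimpleGraph V} {R : V → Set (ℤ × ℤ)}
    (hR : IsGridModel G R) : IsPlanar G := by
  classical
  obtain ⟨F, T, hF, hRT, hT, hfib⟩ :=
    isCollapsible_of_isLinked hR.finite hR.nonempty hR.linked hR.eq_of_mem
  choose ρ hρ using hR.nonempty
  have hch : ∀ e : Sym2 V, ∃ (w : V × V) (k : (ℤ × ℤ) × (ℤ × ℤ)), e ∈ G.edgeSet →
      e = s(w.1, w.2) ∧ w.1 ≠ w.2 ∧ k.1 ∈ R w.1 ∧ k.2 ∈ R w.2 ∧ GridAdj k.1 k.2 := by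
    intro e
    induction e using Sym2.ind with
    | _ u v =>
      by_cases h : G.Adj u v
      · obtain ⟨g, hg, h', hh', hgh⟩ := hR.exists_adj u v h
        exact ⟨(u, v), (g, h'), fun _ => ⟨rfl, h.ne, hg, hh', hgh⟩⟩
      · exact ⟨(u, v), 0, fun h' => (h h').elim⟩
  choose w k hk using hch
  have hTR : ∀ u, ∀ g, gridPoint g ∈ T u → g ∈ R u := by
    intro u g hg
    rcases hT u _ hg with ⟨g', hg', he⟩ | ⟨g', hg', h, hh, hgh, hx, hs⟩
    · rwa [gridPoint_injective he]
    · rcases gridSeg_cases hgh hx with ⟨a, b, h1, e1, e2, e3⟩ | ⟨a, b, h1, e1, e2, e3⟩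
      · obtain ⟨g1, g2⟩ := g
        simp only [gridPoint] at e1 e2 e3
        obtain rfl : g2 = b := by exact_mod_cast e1
        have i1 : a ≤ g1 := by exact_mod_cast e2
        have i2 : g1 ≤ a + 1 := by exact_mod_cast e3
        obtain rfl | rfl : g1 = a ∨ g1 = a + 1 := by omega
        all_goals grind
      · obtain ⟨g1, g2⟩ := g
        simp only [gridPoint] at e1 e2 e3
        obtain rfl : g1 = a := by exact_mod_cast e1
        have i1 : b ≤ g2 := by exact_mod_cast e2
        have i2 : g2 ≤ b + 1 := by exact_mod_cast e3
        obtain rfl | rfl : g2 = b ∨ g2 = b + 1 := by omega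
        all_goals grind
  -- A grid edge chosen to represent an edge of the graph joins two different parts, so it is not in
  -- any tree and meets the trees only at its ends. Hence the collapsing map is injective on it.
  have hseg : ∀ e ∈ G.edgeSet, ∀ x ∈ gridSeg (k e).1 (k e).2, ∀ u, x ∈ T u →
      (u = (w e).1 ∧ x = gridPoint (k e).1) ∨ (u = (w e).2 ∧ x = gridPoint (k e).2) := by
    intro e he x hx u hu
    obtain ⟨-, hw, h1, h2, h12⟩ := hk e he
    have hfin : ∀ g, (g = (k e).1 ∨ g = (k e).2) → g ∈ R u → x = gridPoint g →
        (u = (w e).1 ∧ x = gridPoint (k e).1) ∨ (u = (w e).2 ∧ x = gridPoint (k e).2) := by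
      rintro g (rfl | rfl) hg rfl
      · exact Or.inl ⟨hR.eq_of_mem _ _ _ hg h1, rfl⟩
      · exact Or.inr ⟨hR.eq_of_mem _ _ _ hg h2, rfl⟩
    rcases hT u x hu with ⟨g, hg, rfl⟩ | ⟨g, hg, h, hh, hgh, hx', hs⟩
    · rcases gridSeg_cases h12 hx with ⟨a, b, hk1, e1, e2, e3⟩ | ⟨a, b, hk1, e1, e2, e3⟩
      all_goals
        obtain ⟨g1, g2⟩ := g
        simp only [gridPoint] at e1 e2 e3
      · obtain rfl : g2 = b := by exact_mod_cast e1
        have i1 : a ≤ g1 := by exact_mod_cast e2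
        have i2 : g1 ≤ a + 1 := by exact_mod_cast e3
        refine hfin (g1, g2) ?_ hg rfl
        obtain rfl | rfl : g1 = a ∨ g1 = a + 1 := by omega
        all_goals grind
      · obtain rfl : g1 = a := by exact_mod_cast e1
        have i1 : b ≤ g2 := by exact_mod_cast e2
        have i2 : g2 ≤ b + 1 := by exact_mod_cast e3
        refine hfin (g1, g2) ?_ hg rfl
        obtain rfl | rfl : g2 = b ∨ g2 = b + 1 := by omega
        all_goals grind
    · rcases gridSeg_inter h12 hgh hx hx' with (⟨h3, h4⟩ | ⟨h3, h4⟩) | ⟨g', h3, h4, h5⟩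
      · exact (hw ((hR.eq_of_mem u _ _ (h3 ▸ hg) h1).symm.trans (hR.eq_of_mem u _ _ (h4 ▸ hh) h2))).elim
      · exact (hw ((hR.eq_of_mem u _ _ (h3 ▸ hh) h1).symm.trans (hR.eq_of_mem u _ _ (h4 ▸ hg) h2))).elim
      · refine hfin g' h3 ?_ h5
        rcases h4 with rfl | rfl
        · exact hg
        · exact hh
  have hroot : ∀ v, ∀ g ∈ R v, F (gridPoint g) = F (gridPoint (ρ v)) := fun v g hg =>
    (hfib _ _).2 (Or.inr ⟨v, hRT v g hg, hRT v _ (hρ v)⟩)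
  refine ⟨⟨fun v => planeHomeomorph (F (gridPoint (ρ v))),
    fun e => planeHomeomorph '' (F '' gridSeg (k e).1 (k e).2), ?_, ?_, ?_, ?_⟩⟩
  · intro u v h
    rcases (hfib _ _).1 (planeHomeomorph.injective h) with h | ⟨t, h1, h2⟩
    · exact hR.eq_of_mem u v (ρ u) (hρ u) (gridPoint_injective h ▸ hρ v)
    · rw [← hR.eq_of_mem _ _ _ (hTR _ _ h1) (hρ u), hR.eq_of_mem _ _ _ (hTR _ _ h2) (hρ v)]
  · intro u v huv
    have he : s(u, v) ∈ G.edgeSet := huv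
    obtain ⟨hs, hw, h1, h2, h12⟩ := hk _ he
    have harc : IsArc (planeHomeomorph '' (F '' gridSeg (k s(u, v)).1 (k s(u, v)).2))
        (planeHomeomorph (F (gridPoint (ρ (w s(u, v)).1))))
        (planeHomeomorph (F (gridPoint (ρ (w s(u, v)).2)))) := by
      set a := gridPoint (k s(u, v)).1 with ha
      set b := gridPoint (k s(u, v)).2 with hb
      have hmem : ∀ t : unitInterval, AffineMap.lineMap a b (t : ℝ) ∈
          gridSeg (k s(u, v)).1 (k s(u, v)).2 := fun t => by
        rw [gridSeg, segment_eq_image_lineMap]; exact ⟨t, t.2, rfl⟩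
      have hab : a ≠ b := fun h => h12.ne (gridPoint_injective h)
      refine ⟨⟨⟨fun t => planeHomeomorph (F (AffineMap.lineMap a b (t : ℝ))), ?_⟩, ?_, ?_⟩, ?_, ?_⟩
      · exact planeHomeomorph.continuous.comp (hF.comp (by fun_prop))
      · simp only [Set.Icc.coe_zero, AffineMap.lineMap_apply_zero]
        rw [hroot _ _ h1]
      · simp only [Set.Icc.coe_one, AffineMap.lineMap_apply_one]
        rw [hroot _ _ h2]
      · intro t t' htt
        have htt : F (AffineMap.lineMap a b (t : ℝ)) = F (AffineMap.lineMap a b (t' : ℝ)) :=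
          planeHomeomorph.injective htt
        refine Subtype.ext (AffineMap.lineMap_injective ℝ hab ?_)
        rcases (hfib _ _).1 htt with h | ⟨x, hx, hx'⟩
        · exact h
        · rcases hseg _ he _ (hmem t) x hx with ⟨c1, c2⟩ | ⟨c1, c2⟩ <;>
          rcases hseg _ he _ (hmem t') x hx' with ⟨d1, d2⟩ | ⟨d1, d2⟩
          · rw [c2, d2]
          · exact (hw (c1.symm.trans d1)).elim
          · exact (hw (d1.symm.trans c1)).elim
          · rw [c2, d2]
      · rw [gridSeg, segment_eq_image_lineMap, Set.image_image, Set.image_image,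
          Set.image_eq_range]
        rfl
    -- The chosen representative of the unordered pair may run in either direction; in one case the
    -- path is reversed.
    have hs' := hs
    rw [Sym2.eq_iff] at hs'
    rcases hs' with ⟨e1, e2⟩ | ⟨e1, e2⟩
    · rw [← e1, ← e2] at harc
      exact harc
    · rw [← e1, ← e2] at harc
      obtain ⟨γ, hγ, hr⟩ := harc
      refine ⟨γ.symm, hγ.comp unitInterval.symm_bijective.injective, ?_⟩
      rw [← hr, Path.symm_range]
  · rintro e he v ⟨_, ⟨x, hx, rfl⟩, hxe⟩
    rcases (hfib _ _).1 (planeHomeomorph.injective hxe) with h | ⟨t, h1, h2⟩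
    · have := hseg e he x hx v (h ▸ hRT v _ (hρ v))
      rw [(hk e he).1, Sym2.mem_iff]
      exact this.imp And.left And.left
    · have := hseg e he x hx t h1
      rw [(hk e he).1, Sym2.mem_iff, ← hR.eq_of_mem _ _ _ (hTR _ _ h2) (hρ v)]
      exact this.imp And.left And.left
  · rintro e he f hf hef _ ⟨⟨_, ⟨x, hx, rfl⟩, rfl⟩, ⟨_, ⟨x', hx', rfl⟩, hxx⟩⟩
    have hmem : ∀ e ∈ G.edgeSet, ∀ x ∈ gridSeg (k e).1 (k e).2, ∀ u, x ∈ T u → u ∈ e := by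
      intro e he x hx u hu
      rw [(hk e he).1, Sym2.mem_iff]
      exact (hseg e he x hx u hu).imp And.left And.left
    have hcommon : ∃ t, x ∈ T t ∧ x' ∈ T t := by
      rcases (hfib _ _).1 (planeHomeomorph.injective hxx) with rfl | ⟨t, h1, h2⟩
      · obtain ⟨e0, -, e1, e2, e3⟩ := hk e he
        obtain ⟨f0, -, f1, f2, f3⟩ := hk f hf
        rcases gridSeg_inter e3 f3 hx hx' with (⟨h3, h4⟩ | ⟨h3, h4⟩) | ⟨g', h3, h4, h5⟩
        · rw [h3] at e1; rw [h4] at e2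
          exact (hef (by rw [e0, f0, hR.eq_of_mem _ _ _ e1 f1, hR.eq_of_mem _ _ _ e2 f2])).elim
        · rw [h3] at e1; rw [h4] at e2
          exact (hef (by rw [e0, f0, hR.eq_of_mem _ _ _ e1 f2, hR.eq_of_mem _ _ _ e2 f1,
            Sym2.eq_swap])).elim
        · rcases h3 with rfl | rfl
          · exact ⟨_, h5 ▸ hRT _ _ e1, h5 ▸ hRT _ _ e1⟩
          · exact ⟨_, h5 ▸ hRT _ _ e2, h5 ▸ hRT _ _ e2⟩
      · exact ⟨t, h2, h1⟩
    obtain ⟨t, h1, h2⟩ := hcommon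
    exact ⟨t, hmem e he x hx t h1, hmem f hf x' hx' t h2, congrArg _
      ((hfib _ _).2 (Or.inr ⟨t, h1, hRT t _ (hρ t)⟩))⟩

end CliqueHierarchy
-- Trees in the refined grid do not separate it
namespace CliqueHierarchy

theorem isLinked_univ_grid : IsLinked GridAdj Set.univ := by
  have h : pixels 1 Set.univ = Set.univ := by
    refine Set.eq_univ_of_forall fun z => ⟨!₂[(z.1 : ℝ), (z.2 : ℝ)], Set.mem_univ _, ?_, ?_⟩ <;>
      simp
  rw [← h]
  exact isLinked_pixels isPreconnected_univ

/-- If every neighbour of `D` outside `M ∪ D` can be joined to a fixed point outside `M ∪ D`, then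
removing `D` does not destroy connectivity of the complement of `M`. -/
theorem IsLinked.compl_union {M D : Set (ℤ × ℤ)} (hM : IsLinked GridAdj Mᶜ) {c : ℤ × ℤ}
    (hc : ∀ a ∈ D, ∀ b ∈ (M ∪ D)ᶜ, GridAdj a b → Joined GridAdj (M ∪ D)ᶜ c b) :
    IsLinked GridAdj (M ∪ D)ᶜ := by
  intro x hx z hz
  have hsub : ∀ {x}, x ∈ (M ∪ D)ᶜ → x ∈ Mᶜ := fun hx h => hx (Or.inl h)
  have key : ∀ z, Joined GridAdj Mᶜ x z →
      (z ∉ D → Joined GridAdj (M ∪ D)ᶜ x z) ∧ (z ∈ D → Joined GridAdj (M ∪ D)ᶜ x c) := by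
    intro z hz
    induction hz with
    | refl => exact ⟨fun _ => Relation.ReflTransGen.refl, fun h => (hx (Or.inr h)).elim⟩
    | @tail a b _ hab ih =>
      obtain ⟨hab, ha, hb⟩ := hab
      by_cases haD : a ∈ D <;> by_cases hbD : b ∈ D
      · exact ⟨fun h => (h hbD).elim, fun _ => ih.2 haD⟩
      · refine ⟨fun _ => (ih.2 haD).trans (hc a haD b ?_ hab), fun h => (hbD h).elim⟩
        rintro (h | h)
        · exact hb h
        · exact hbD h
      · refine ⟨fun h => (h hbD).elim, fun _ => (ih.1 haD).trans
          ((hc b hbD a ?_ (GridAdj.symm _ _ hab)).symm GridAdj.symm)⟩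
        rintro (h | h)
        · exact ha h
        · exact haD h
      · refine ⟨fun _ => (ih.1 haD).trans (Joined.single hab ?_ ?_), fun h => (hbD h).elim⟩
        · rintro (h | h)
          · exact ha h
          · exact haD h
        · rintro (h | h)
          · exact hb h
          · exact hbD h
  exact (key z (hM x (hsub hx) z (hsub hz))).1 fun h => hz (Or.inr h)

/-- The image of a grid point in the grid of half the mesh size. -/
def double (g : ℤ × ℤ) : ℤ × ℤ := (2 * g.1, 2 * g.2)

/-- The midpoint of two adjacent grid points in the grid of half the mesh size. -/
def midpt (g h : ℤ × ℤ) : ℤ × ℤ := (g.1 + h.1, g.2 + h.2)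

/-- The lower of the two ends of the edge with midpoint `m`. -/
def lowEnd (m : ℤ × ℤ) : ℤ × ℤ := (m.1 / 2, m.2 / 2)

/-- The upper of the two ends of the edge with midpoint `m`. -/
def highEnd (m : ℤ × ℤ) : ℤ × ℤ := ((m.1 + 1) / 2, (m.2 + 1) / 2)

/-- The points of the refined grid which are grid points or midpoints of grid edges. -/
def IsOnEdge (m : ℤ × ℤ) : Prop := m.1 % 2 = 0 ∨ m.2 % 2 = 0

/-- The subdivision of the subgraph of the grid induced on `S`. -/
def subdivision (S : Set (ℤ × ℤ)) : Set (ℤ × ℤ) := {m | IsOnEdge m ∧ lowEnd m ∈ S ∧ highEnd m ∈ S}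

theorem subdivision_mono {S T : Set (ℤ × ℤ)} (h : S ⊆ T) : subdivision S ⊆ subdivision T :=
  fun _ hm => ⟨hm.1, h hm.2.1, h hm.2.2⟩

theorem isOnEdge_double (g : ℤ × ℤ) : IsOnEdge (double g) := by
  simp [IsOnEdge, double]

theorem lowEnd_double (g : ℤ × ℤ) : lowEnd (double g) = g := by
  simp [lowEnd, double]

theorem highEnd_double (g : ℤ × ℤ) : highEnd (double g) = g := by
  obtain ⟨a, b⟩ := g
  simp only [highEnd, double, Prod.mk.injEq]; omega

theorem isOnEdge_midpt {g h : ℤ × ℤ} (hgh : GridAdj g h) : IsOnEdge (midpt g h) := by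
  simp only [IsOnEdge, midpt, GridAdj] at *; omega

theorem ends_midpt {g h : ℤ × ℤ} (hgh : GridAdj g h) :
    (lowEnd (midpt g h) = g ∧ highEnd (midpt g h) = h) ∨
      (lowEnd (midpt g h) = h ∧ highEnd (midpt g h) = g) := by
  simp only [lowEnd, highEnd, midpt, GridAdj, Prod.ext_iff] at *; omega

theorem midpt_comm (g h : ℤ × ℤ) : midpt g h = midpt h g := by
  simp [midpt, add_comm]

theorem gridAdj_double_midpt {g h : ℤ × ℤ} (hgh : GridAdj g h) :
    GridAdj (double g) (midpt g h) := by
  simp only [double, midpt, GridAdj] at *; omega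

theorem double_mem_subdivision {S : Set (ℤ × ℤ)} {g : ℤ × ℤ} (hg : g ∈ S) : double g ∈ subdivision S :=
  ⟨isOnEdge_double g, by rwa [lowEnd_double], by rwa [highEnd_double]⟩

theorem midpt_mem_subdivision {S : Set (ℤ × ℤ)} {g h : ℤ × ℤ} (hgh : GridAdj g h) (hg : g ∈ S)
    (hh : h ∈ S) : midpt g h ∈ subdivision S := by
  refine ⟨isOnEdge_midpt hgh, ?_⟩
  rcases ends_midpt hgh with ⟨e1, e2⟩ | ⟨e1, e2⟩ <;> rw [e1, e2]
  · exact ⟨hg, hh⟩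
  · exact ⟨hh, hg⟩

/-- The eight surrounding points link the four neighbours of the removed point. -/
theorem isLinked_compl_singleton (p : ℤ × ℤ) : IsLinked GridAdj (∅ ∪ {p} : Set (ℤ × ℤ))ᶜ := by
  obtain ⟨a, b⟩ := p
  refine IsLinked.compl_union (c := (a + 1, b + 1))
    (by rw [Set.compl_empty]; exact isLinked_univ_grid) ?_
  have hm : ∀ i j : ℤ, (i ≠ 0 ∨ j ≠ 0) → (a + i, b + j) ∈ (∅ ∪ {(a, b)} : Set (ℤ × ℤ))ᶜ := by
    intro i j h; simp; omega
  have st : ∀ i j i' j' : ℤ, (i ≠ 0 ∨ j ≠ 0) → (i' ≠ 0 ∨ j' ≠ 0) →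
      GridAdj (a + i, b + j) (a + i', b + j') →
      Joined GridAdj (∅ ∪ {(a, b)} : Set (ℤ × ℤ))ᶜ (a + i, b + j) (a + i', b + j') :=
    fun i j i' j' h h' h'' => Joined.single h'' (hm _ _ h) (hm _ _ h')
  have adj : ∀ i j i' j' : ℤ, (i = i' ∧ (j = j' + 1 ∨ j' = j + 1) ∨
      j = j' ∧ (i = i' + 1 ∨ i' = i + 1)) → GridAdj (a + i, b + j) (a + i', b + j') := by
    intro i j i' j' h; simp only [GridAdj]; omega
  have j1 := st 1 1 1 0 (by simp) (by simp) (adj _ _ _ _ (by simp))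
  have j2 := st 1 1 0 1 (by simp) (by simp) (adj _ _ _ _ (by simp))
  have j3 := (j1.trans (st 1 0 1 (-1) (by simp) (by simp) (adj _ _ _ _ (by simp)))).trans
    (st 1 (-1) 0 (-1) (by simp) (by simp) (adj _ _ _ _ (by simp)))
  have j4 := (j2.trans (st 0 1 (-1) 1 (by simp) (by simp) (adj _ _ _ _ (by simp)))).trans
    (st (-1) 1 (-1) 0 (by simp) (by simp) (adj _ _ _ _ (by simp)))
  rintro _ rfl ⟨c, d⟩ hcd hadj
  have : (c = a + 1 ∧ d = b + 0) ∨ (c = a + 0 ∧ d = b + 1) ∨ (c = a + 0 ∧ d = b + -1) ∨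
      (c = a + -1 ∧ d = b + 0) := by
    simp only [GridAdj] at hadj; omega
  rcases this with ⟨rfl, rfl⟩ | ⟨rfl, rfl⟩ | ⟨rfl, rfl⟩ | ⟨rfl, rfl⟩
  · exact j1
  · exact j2
  · exact j3
  · exact j4

theorem gridAdj_add {i j : ℤ} (hij : (i = 1 ∧ j = 0) ∨ (i = -1 ∧ j = 0) ∨ (i = 0 ∧ j = 1) ∨
    (i = 0 ∧ j = -1)) {p q p' q' : ℤ} (hp : p' = p + i) (hq : q' = q + j) :
    GridAdj (p, q) (p', q') := by
  simp only [GridAdj]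
  rcases hij with ⟨rfl, rfl⟩ | ⟨rfl, rfl⟩ | ⟨rfl, rfl⟩ | ⟨rfl, rfl⟩ <;> omega

/-- Attaching a leaf edge to a subdivided tree does not separate the grid. -/
theorem IsLinked.compl_leaf {M S : Set (ℤ × ℤ)} (hM : IsLinked GridAdj Mᶜ) (hMS : M ⊆ subdivision S)
    {y l : ℤ × ℤ} (hyl : GridAdj y l) (hy : double y ∈ M) (hl : l ∉ S) :
    IsLinked GridAdj (M ∪ {midpt y l, double l})ᶜ := by
  obtain ⟨a, b⟩ := y
  obtain ⟨i, j, hij, rfl⟩ : ∃ i j : ℤ, ((i = 1 ∧ j = 0) ∨ (i = -1 ∧ j = 0) ∨ (i = 0 ∧ j = 1) ∨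
      (i = 0 ∧ j = -1)) ∧ l = (a + i, b + j) := by
    obtain ⟨c, d⟩ := l
    refine ⟨c - a, d - b, ?_, by simp⟩
    simp only [GridAdj] at hyl; omega
  set N := M ∪ {midpt (a, b) (a + i, b + j), double (a + i, b + j)} with hN
  -- Points available for the detour: face centres (both coordinates odd), and points on edges with
  -- end $l$ other than the two removed ones. The latter are free because $l\notin S$; the former
  -- exist only because the mesh was halved.
  have hr : ∀ p : ℤ × ℤ, ((p.1 % 2 = 1 ∧ p.2 % 2 = 1) ∨
      ((p.1 / 2 = a + i ∧ p.2 / 2 = b + j ∨ (p.1 + 1) / 2 = a + i ∧ (p.2 + 1) / 2 = b + j) ∧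
      (p.1 ≠ 2 * a + i ∨ p.2 ≠ 2 * b + j) ∧ (p.1 ≠ 2 * a + 2 * i ∨ p.2 ≠ 2 * b + 2 * j))) →
      p ∈ Nᶜ := by
    rintro ⟨p, q⟩ hp hpN
    simp only at hp
    rcases hpN with h | h
    · obtain ⟨h0, h1, h2⟩ := hMS h
      simp only [IsOnEdge] at h0
      rcases hp with hp | ⟨⟨hp, hp'⟩ | ⟨hp, hp'⟩, -⟩
      · omega
      · exact hl (by rwa [lowEnd, hp, hp'] at h1)
      · exact hl (by rwa [highEnd, hp, hp'] at h2)
    · simp only [midpt, double, Set.mem_insert_iff, Set.mem_singleton_iff, Prod.mk.injEq] at h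
      omega
  -- With $(i,j)$ the direction from $y$ to $l$ and $(-j,i)$ its perpendicular, the points `c0` to
  -- `c6` run up one side of the new edge, round its tip and back down the other side.
  have c0 : (2 * a + i - j, 2 * b + j + i) ∈ Nᶜ := hr _ (by
    rcases hij with ⟨rfl, rfl⟩ | ⟨rfl, rfl⟩ | ⟨rfl, rfl⟩ | ⟨rfl, rfl⟩ <;> simp only <;> omega)
  have c1 : (2 * a + 2 * i - j, 2 * b + 2 * j + i) ∈ Nᶜ := hr _ (by
    rcases hij with ⟨rfl, rfl⟩ | ⟨rfl, rfl⟩ | ⟨rfl, rfl⟩ | ⟨rfl, rfl⟩ <;> simp only <;> omega)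
  have c2 : (2 * a + 3 * i - j, 2 * b + 3 * j + i) ∈ Nᶜ := hr _ (by
    rcases hij with ⟨rfl, rfl⟩ | ⟨rfl, rfl⟩ | ⟨rfl, rfl⟩ | ⟨rfl, rfl⟩ <;> simp only <;> omega)
  have c3 : (2 * a + 3 * i, 2 * b + 3 * j) ∈ Nᶜ := hr _ (by
    rcases hij with ⟨rfl, rfl⟩ | ⟨rfl, rfl⟩ | ⟨rfl, rfl⟩ | ⟨rfl, rfl⟩ <;> simp only <;> omega)
  have c4 : (2 * a + 3 * i + j, 2 * b + 3 * j - i) ∈ Nᶜ := hr _ (by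
    rcases hij with ⟨rfl, rfl⟩ | ⟨rfl, rfl⟩ | ⟨rfl, rfl⟩ | ⟨rfl, rfl⟩ <;> simp only <;> omega)
  have c5 : (2 * a + 2 * i + j, 2 * b + 2 * j - i) ∈ Nᶜ := hr _ (by
    rcases hij with ⟨rfl, rfl⟩ | ⟨rfl, rfl⟩ | ⟨rfl, rfl⟩ | ⟨rfl, rfl⟩ <;> simp only <;> omega)
  have c6 : (2 * a + i + j, 2 * b + j - i) ∈ Nᶜ := hr _ (by
    rcases hij with ⟨rfl, rfl⟩ | ⟨rfl, rfl⟩ | ⟨rfl, rfl⟩ | ⟨rfl, rfl⟩ <;> simp only <;> omega)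
  have hij2 : (-i = 1 ∧ -j = 0) ∨ (-i = -1 ∧ -j = 0) ∨ (-i = 0 ∧ -j = 1) ∨
    (-i = 0 ∧ -j = -1) := by omega
  have hij3 : (j = 1 ∧ -i = 0) ∨ (j = -1 ∧ -i = 0) ∨ (j = 0 ∧ -i = 1) ∨
    (j = 0 ∧ -i = -1) := by omega
  have j1 : Joined GridAdj Nᶜ _ _ := Joined.single (gridAdj_add hij (by ring) (by ring)) c0 c1
  have j2 := j1.trans (Joined.single (gridAdj_add hij (by ring) (by ring)) c1 c2)
  have j3 := j2.trans (Joined.single (gridAdj_add hij3 (by ring) (by ring)) c2 c3)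
  have j4 := j3.trans (Joined.single (gridAdj_add hij3 (by ring) (by ring)) c3 c4)
  have j5 := j4.trans (Joined.single (gridAdj_add hij2 (by ring) (by ring)) c4 c5)
  have j6 := j5.trans (Joined.single (gridAdj_add hij2 (by ring) (by ring)) c5 c6)
  refine hM.compl_union (c := (2 * a + i - j, 2 * b + j + i)) ?_
  rintro p hp ⟨c, d⟩ hcd hadj
  have hne1 : ¬ (c = 2 * a ∧ d = 2 * b) := by
    rintro ⟨rfl, rfl⟩; exact hcd (Or.inl hy)
  have hne2 : ¬ (c = 2 * a + i ∧ d = 2 * b + j) := by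
    rintro ⟨rfl, rfl⟩; refine hcd (Or.inr (Or.inl ?_)); simp only [midpt, Prod.mk.injEq]; omega
  have hne3 : ¬ (c = 2 * (a + i) ∧ d = 2 * (b + j)) := by
    rintro ⟨rfl, rfl⟩; exact hcd (Or.inr (Or.inr rfl))
  have : (c = 2 * a + i - j ∧ d = 2 * b + j + i) ∨ (c = 2 * a + 2 * i - j ∧ d = 2 * b + 2 * j + i) ∨
      (c = 2 * a + 3 * i ∧ d = 2 * b + 3 * j) ∨ (c = 2 * a + 2 * i + j ∧ d = 2 * b + 2 * j - i) ∨
      (c = 2 * a + i + j ∧ d = 2 * b + j - i) := by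
    clear_value N
    clear j1 j2 j3 j4 j5 j6 c0 c1 c2 c3 c4 c5 c6 hij2 hij3 hr
    rcases hp with rfl | rfl <;> simp only [GridAdj, midpt, double] at hadj <;>
      rcases hij with ⟨rfl, rfl⟩ | ⟨rfl, rfl⟩ | ⟨rfl, rfl⟩ | ⟨rfl, rfl⟩ <;> omega
  rcases this with ⟨rfl, rfl⟩ | ⟨rfl, rfl⟩ | ⟨rfl, rfl⟩ | ⟨rfl, rfl⟩ | ⟨rfl, rfl⟩
  · exact Relation.ReflTransGen.refl
  · exact j1
  · exact j3
  · exact j5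
  · exact j6

/-- A finite linked set `A` of grid points contains a subdivided spanning tree `M`: gluing it to
something in its root `r` does not separate the grid. -/
theorem exists_tree {A : Set (ℤ × ℤ)} (hA : IsLinked GridAdj A) (hfin : A.Finite) {r : ℤ × ℤ}
    (hr : r ∈ A) : ∃ M ⊆ subdivision A, (∀ g ∈ A, double g ∈ M) ∧ IsLinked GridAdj M ∧
      ∀ S N, N ⊆ subdivision S → (∀ x ∈ S, x ∈ A → x = r) →
        IsLinked GridAdj (N ∪ {double r})ᶜ → IsLinked GridAdj (N ∪ M)ᶜ := by
  -- The set $N$ is kept arbitrary so that trees can be glued: it is taken empty for the first tree,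
  -- and equal to the first tree with a leaf edge for the second. Since $S$ meets $A$ at most in the
  -- root, each newly added leaf is new to $S$ as well.
  have key := hA.induction_on hfin hr (Q := fun B => r ∈ B ∧
    ∃ M ⊆ subdivision B, (∀ g ∈ B, double g ∈ M) ∧ IsLinked GridAdj M ∧
      ∀ S N, N ⊆ subdivision S → (∀ x ∈ S, x ∈ A → x = r) →
        IsLinked GridAdj (N ∪ {double r})ᶜ → IsLinked GridAdj (N ∪ M)ᶜ) ?_ ?_
  · exact key.2
  · refine ⟨rfl, {double r}, ?_, ?_, isLinked_singleton, fun S N _ _ h => h⟩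
    · rintro _ rfl; exact double_mem_subdivision rfl
    · rintro g rfl; rfl
  · rintro B hB ⟨hrB, M, hM, hBM, hlM, hcon⟩ y hy l hl hlB hyl
    refine ⟨Or.inr hrB, M ∪ {midpt y l, double l}, ?_, ?_, ?_, ?_⟩
    · rintro m (hm | rfl | rfl)
      · exact subdivision_mono (Set.subset_insert _ _) (hM hm)
      · exact midpt_mem_subdivision hyl (Or.inr hy) (Or.inl rfl)
      · exact double_mem_subdivision (Or.inl rfl)
    · rintro g (rfl | hg)
      · exact Or.inr (Or.inr rfl)
      · exact Or.inl (hBM g hg)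
    · have h1 := hlM.insert_adj GridAdj.symm (hBM y hy) (gridAdj_double_midpt hyl)
      have h2 := h1.insert_adj GridAdj.symm (Set.mem_insert _ _) (y := double l)
        (by rw [midpt_comm]; exact GridAdj.symm _ _ (gridAdj_double_midpt (GridAdj.symm _ _ hyl)))
      have : M ∪ {midpt y l, double l} = insert (double l) (insert (midpt y l) M) := by
        ext x; simp only [Set.mem_union, Set.mem_insert_iff, Set.mem_singleton_iff]; tauto
      rwa [this]
    · intro S N hN hS hl'
      rw [← Set.union_assoc]
      refine (hcon S N hN hS hl').compl_leaf (S := S ∪ B) ?_ hyl (Or.inr (hBM y hy)) ?_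
      · exact Set.union_subset (hN.trans (subdivision_mono Set.subset_union_left))
          (hM.trans (subdivision_mono Set.subset_union_right))
      · rintro (h | h)
        · exact hlB (hS l h hl ▸ hrB)
        · exact hlB h

end CliqueHierarchy
-- Refined models and adding an edge
namespace CliqueHierarchy

variable {V : Type*}

theorem finite_setOf_ends {S : Set (ℤ × ℤ)} (hS : S.Finite) :
    {m | lowEnd m ∈ S ∨ highEnd m ∈ S}.Finite := by
  refine (hS.biUnion (t := fun g => Set.Icc (2 * g.1 - 1) (2 * g.1 + 1) ×ˢ
    Set.Icc (2 * g.2 - 1) (2 * g.2 + 1)) fun g _ =>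
      (Set.finite_Icc _ _).prod (Set.finite_Icc _ _)).subset ?_
  rintro ⟨p, q⟩ (h | h) <;> refine Set.mem_biUnion h ?_ <;>
    simp only [lowEnd, highEnd, Set.mem_prod, Set.mem_Icc] <;> omega

theorem gridAdj_or_eq_of_isOnEdge {m : ℤ × ℤ} (hm : IsOnEdge m) :
    (GridAdj (double (lowEnd m)) m ∨ double (lowEnd m) = m) ∧
    (GridAdj (double (highEnd m)) m ∨ double (highEnd m) = m) := by
  obtain ⟨p, q⟩ := m
  simp only [GridAdj, double, lowEnd, highEnd, IsOnEdge, Prod.mk.injEq] at *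
  omega

/-- The part of label `w` in the refinement of a model `R`, where midpoints of edges between
differently labelled points are given to an end with label outside `X`. -/
def refinedPart (R : V → Set (ℤ × ℤ)) (X : Set V) (w : V) : Set (ℤ × ℤ) :=
  {m | IsOnEdge m ∧ (lowEnd m ∈ R w ∨ (highEnd m ∈ R w ∧ ∀ x ∉ X, lowEnd m ∉ R x))}

section
variable {R : V → Set (ℤ × ℤ)} {X : Set V} {w : V}

theorem double_mem_refinedPart {g : ℤ × ℤ} (hg : g ∈ R w) : double g ∈ refinedPart R X w :=
  ⟨isOnEdge_double g, Or.inl (by rwa [lowEnd_double])⟩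

theorem isLinked_refinedPart (hl : IsLinked GridAdj (R w)) (hne : (R w).Nonempty) :
    IsLinked GridAdj (refinedPart R X w) := by
  have hdd : ∀ g ∈ R w, ∀ h ∈ R w, Joined GridAdj (refinedPart R X w) (double g) (double h) := by
    intro g hg h hh
    induction hl g hg h hh with
    | refl => exact Relation.ReflTransGen.refl
    | @tail a b _ h ih =>
      obtain ⟨hab, ha, hb⟩ := h
      have hm : midpt a b ∈ refinedPart R X w := by
        refine ⟨isOnEdge_midpt hab, Or.inl ?_⟩
        rcases ends_midpt hab with ⟨e, -⟩ | ⟨e, -⟩ <;> rwa [e]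
      refine ((ih ha).trans (Joined.single (gridAdj_double_midpt hab)
        (double_mem_refinedPart ha) hm)).trans (Joined.single ?_ hm (double_mem_refinedPart hb))
      rw [midpt_comm]
      exact GridAdj.symm _ _ (gridAdj_double_midpt (GridAdj.symm _ _ hab))
  obtain ⟨g₀, hg₀⟩ := hne
  refine IsLinked.of_root GridAdj.symm (x := double g₀) fun m hm => ?_
  have key : ∀ g ∈ R w, (GridAdj (double g) m ∨ double g = m) →
      Joined GridAdj (refinedPart R X w) (double g₀) m := by
    rintro g hg (h | h)
    · exact (hdd _ hg₀ g hg).trans (Joined.single h (double_mem_refinedPart hg) hm)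
    · exact h ▸ hdd _ hg₀ g hg
  rcases hm.2 with h | ⟨h, -⟩
  · exact key _ h (gridAdj_or_eq_of_isOnEdge hm.1).1
  · exact key _ h (gridAdj_or_eq_of_isOnEdge hm.1).2

/-- A midpoint goes to its upper end only if its lower end has no label outside $X$, so a label
outside $X$ never loses its lower midpoints and no midpoint is claimed twice. -/
theorem eq_of_mem_refinedPart (hd : ∀ u v x, x ∈ R u → x ∈ R v → u = v) {u v : V} (hu : u ∉ X)
    (hv : v ∉ X) {m : ℤ × ℤ} (hmu : m ∈ refinedPart R X u) (hmv : m ∈ refinedPart R X v) :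
    u = v := by
  rcases hmu.2 with h | ⟨h, h'⟩ <;> rcases hmv.2 with k | ⟨k, k'⟩
  · exact hd _ _ _ h k
  · exact (k' u hu h).elim
  · exact (h' v hv k).elim
  · exact hd _ _ _ h k

theorem not_mem_refinedPart (hd : ∀ u v x, x ∈ R u → x ∈ R v → u = v) (hw : w ∉ X)
    {S : Set (ℤ × ℤ)} (hS : ∀ g ∈ S, ∃ x ∈ X, g ∈ R x) {m : ℤ × ℤ} (hm : m ∈ subdivision S) :
    m ∉ refinedPart R X w := by
  rintro ⟨-, h | ⟨h, -⟩⟩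
  · obtain ⟨x, hx, hx'⟩ := hS _ hm.2.1
    exact hw (hd _ _ _ h hx' ▸ hx)
  · obtain ⟨x, hx, hx'⟩ := hS _ hm.2.2
    exact hw (hd _ _ _ h hx' ▸ hx)

theorem midpt_mem_refinedPart (hd : ∀ u v x, x ∈ R u → x ∈ R v → u = v) {u v : V}
    {g h : ℤ × ℤ} (hgh : GridAdj g h) (hg : g ∈ R u) (hh : h ∈ R v) :
    midpt g h ∈ refinedPart R X v ∨ (u ∉ X ∧ midpt g h ∈ refinedPart R X u) := by
  rcases ends_midpt hgh with ⟨e1, e2⟩ | ⟨e1, e2⟩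
  · by_cases hu : u ∈ X
    · refine Or.inl ⟨isOnEdge_midpt hgh, Or.inr ⟨by rwa [e2], fun x hx hx' => ?_⟩⟩
      rw [e1] at hx'
      exact hx (hd _ _ _ hx' hg ▸ hu)
    · exact Or.inr ⟨hu, isOnEdge_midpt hgh, Or.inl (by rwa [e1])⟩
  · exact Or.inl ⟨isOnEdge_midpt hgh, Or.inl (by rwa [e1])⟩

end

/-- A model of `G` and a set of unused grid points joining two parts give a model of `G` with one
more edge. -/
theorem IsGridModel.sup_edge {G : SimpleGraph V} {R : V → Set (ℤ × ℤ)} (hR : IsGridModel G R)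
    {u v : V} (huv : u ≠ v) {D : Set (ℤ × ℤ)} (hfin : D.Finite) (hD : ∀ x ∈ D, ∀ w, x ∉ R w)
    (hl : IsLinked GridAdj (R u ∪ D)) {g h : ℤ × ℤ} (hg : g ∈ R u ∪ D) (hh : h ∈ R v)
    (hgh : GridAdj g h) : ∃ R', IsGridModel (G ⊔ SimpleGraph.edge u v) R' := by
  classical
  have hsub : ∀ w, R w ⊆ Function.update R u (R u ∪ D) w := by
    intro w
    by_cases hw : w = u
    · subst hw; simp
    · rw [Function.update_of_ne hw]
  have hadj : ∃ g ∈ Function.update R u (R u ∪ D) u, ∃ h ∈ Function.update R u (R u ∪ D) v,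
      GridAdj g h :=
    ⟨g, by simpa using hg, h, hsub v hh, hgh⟩
  refine ⟨Function.update R u (R u ∪ D), ⟨fun w => ?_, fun w => (hR.nonempty w).mono (hsub w),
    fun w => ?_, fun w z x hw hz => ?_, fun w z hwz => ?_⟩⟩
  · by_cases hw : w = u
    · subst hw; simpa using ⟨hR.finite w, hfin⟩
    · rw [Function.update_of_ne hw]; exact hR.finite w
  · by_cases hw : w = u
    · subst hw; simpa using hl
    · rw [Function.update_of_ne hw]; exact hR.linked w
  · by_cases hwu : w = u <;> by_cases hzu : z = u
    · rw [hwu, hzu]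
    · subst hwu
      rw [Function.update_self] at hw
      rw [Function.update_of_ne hzu] at hz
      rcases hw with hw | hw
      · exact hR.eq_of_mem _ _ _ hw hz
      · exact (hD x hw z hz).elim
    · subst hzu
      rw [Function.update_self] at hz
      rw [Function.update_of_ne hwu] at hw
      rcases hz with hz | hz
      · exact hR.eq_of_mem _ _ _ hw hz
      · exact (hD x hz w hw).elim
    · rw [Function.update_of_ne hwu] at hw
      rw [Function.update_of_ne hzu] at hz
      exact hR.eq_of_mem _ _ _ hw hz
  · rw [SimpleGraph.sup_adj, SimpleGraph.edge_adj] at hwz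
    rcases hwz with hwz | ⟨⟨rfl, rfl⟩ | ⟨rfl, rfl⟩, -⟩
    · obtain ⟨g, hg, h, hh, hgh⟩ := hR.exists_adj w z hwz
      exact ⟨g, hsub w hg, h, hsub z hh, hgh⟩
    · exact hadj
    · obtain ⟨g, hg, h, hh, hgh⟩ := hadj
      exact ⟨h, hh, g, hg, GridAdj.symm _ _ hgh⟩

/-- If the ends of an edge `b c` of a grid minor separate `P₁` from `P₂`, then an edge between `P₁`
and `P₂` can be added. -/
theorem IsGridModel.exists_add_edge {G : SimpleGraph V} {R : V → Set (ℤ × ℤ)}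
    (hR : IsGridModel G R) {b c : V} (hbc : G.Adj b c) {P₁ P₂ : Set V} (h₁ : P₁.Nonempty)
    (h₂ : P₂.Nonempty) (hd : Disjoint P₁ P₂)
    (hcov : ∀ v, v ∈ P₁ ∨ v ∈ P₂ ↔ v ∉ ({b, c} : Set V)) :
    ∃ u ∈ P₁, ∃ v ∈ P₂, ∃ R', IsGridModel (G ⊔ SimpleGraph.edge u v) R' := by
  classical
  obtain ⟨y, hy, r, hr, hyr⟩ := hR.exists_adj b c hbc
  have hbcne : b ≠ c := hbc.ne
  obtain ⟨Mb, hMb, hbM, hlb, hcb⟩ := exists_tree (hR.linked b) (hR.finite b) hy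
  obtain ⟨Mc, hMc, hcM, hlc, hcc⟩ := exists_tree (hR.linked c) (hR.finite c) hr
  have hrb : r ∉ R b := fun h => hbcne (hR.eq_of_mem _ _ _ h hr)
  -- the complement of the subdivided tree on the parts of `b` and `c` is linked
  set Mb' := insert (midpt y r) Mb with hMb'
  have hT : IsLinked GridAdj (Mb' ∪ Mc)ᶜ := by
    -- The tree is assembled in three stages: the tree of $b$ rooted at $y$, the leaf edge from $y$
    -- to $r$, and the tree of $c$ glued at $r$.
    have e1 : IsLinked GridAdj Mbᶜ := by
      have := hcb ∅ ∅ (Set.empty_subset _) (by simp) (isLinked_compl_singleton _)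
      rwa [Set.empty_union] at this
    have e2 := e1.compl_leaf hMb hyr (hbM y hy) hrb
    refine hcc (insert r (R b)) Mb' ?_ ?_ ?_
    · rintro m (rfl | hm)
      · exact midpt_mem_subdivision hyr (Or.inr hy) (Or.inl rfl)
      · exact subdivision_mono (Set.subset_insert _ _) (hMb hm)
    · rintro x (rfl | hx) hxc
      · rfl
      · exact (hbcne (hR.eq_of_mem _ _ _ hx hxc)).elim
    · convert e2 using 2
      ext x; simp only [hMb', Set.mem_union, Set.mem_insert_iff, Set.mem_singleton_iff]; tauto
  set X : Set V := {b, c} with hX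
  -- For $b$ and $c$ only spanning trees are kept, since their full subdivisions could contain
  -- cycles enclosing faces. The other parts receive all their midpoints, including those shared
  -- with $b$ or $c$, so no adjacency is lost.
  let R' : V → Set (ℤ × ℤ) := fun w => if w = b then Mb' else if w = c then Mc else
    refinedPart R X w
  have hR'b : R' b = Mb' := by simp [R']
  have hR'c : R' c = Mc := by simp [R', hbcne.symm]
  have hR'w : ∀ w, w ∉ X → R' w = refinedPart R X w := by
    intro w hw
    simp only [hX, Set.mem_insert_iff, Set.mem_singleton_iff, not_or] at hw
    simp [R', hw.1, hw.2]
  have hXT : ∀ w ∉ X, ∀ m ∈ R' w, m ∉ Mb' ∪ Mc := by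
    intro w hw m hm hmT
    rw [hR'w w hw] at hm
    refine not_mem_refinedPart (S := R b ∪ R c) hR.eq_of_mem hw ?_ ?_ hm
    · rintro g (hg | hg)
      · exact ⟨b, by simp [hX], hg⟩
      · exact ⟨c, by simp [hX], hg⟩
    · rcases hmT with (rfl | hm) | hm
      · exact midpt_mem_subdivision hyr (Or.inl hy) (Or.inr hr)
      · exact subdivision_mono Set.subset_union_left (hMb hm)
      · exact subdivision_mono Set.subset_union_right (hMc hm)
  have hdbl : ∀ w, ∀ g ∈ R w, double g ∈ R' w := by
    intro w g hg
    by_cases hwb : w = b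
    · subst hwb; rw [hR'b]; exact Or.inr (hbM g hg)
    by_cases hwc : w = c
    · subst hwc; rw [hR'c]; exact hcM g hg
    · rw [hR'w w (by simp [hX, hwb, hwc])]; exact double_mem_refinedPart hg
  have hbT : ∀ m ∈ R' b, m ∈ Mb' ∪ Mc := fun m hm => Or.inl (hR'b ▸ hm)
  have hcT : ∀ m ∈ R' c, m ∈ Mb' ∪ Mc := fun m hm => Or.inr (hR'c ▸ hm)
  have hbcdis : ∀ m ∈ R' b, m ∉ R' c := by
    intro m hm hmc
    rw [hR'b] at hm
    rw [hR'c] at hmc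
    have hmc := hMc hmc
    have hnb : m ∉ subdivision (R b) := fun h => hbcne (hR.eq_of_mem _ _ _ h.2.1 hmc.2.1)
    rcases hm with rfl | hm
    · rcases ends_midpt hyr with ⟨e, -⟩ | ⟨-, e⟩
      · exact hbcne (hR.eq_of_mem _ _ _ hy (e ▸ hmc.2.1))
      · exact hbcne (hR.eq_of_mem _ _ _ hy (e ▸ hmc.2.2))
    · exact hnb (hMb hm)
  have hmodel : IsGridModel G R' := by
    have hcases : ∀ w, w = b ∨ w = c ∨ w ∉ X := by
      intro w; simp only [hX, Set.mem_insert_iff, Set.mem_singleton_iff]; tauto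
    have hadj1 : ∀ u v, G.Adj u v → v ∉ X → ∃ g ∈ R' u, ∃ h ∈ R' v, GridAdj g h := by
      intro u v huv hv
      obtain ⟨g, hg, h, hh, hgh⟩ := hR.exists_adj u v huv
      rcases midpt_mem_refinedPart hR.eq_of_mem hgh hg hh with hm | ⟨hu, hm⟩
      · exact ⟨_, hdbl u g hg, _, (hR'w v hv).symm ▸ hm, gridAdj_double_midpt hgh⟩
      · refine ⟨_, (hR'w u hu).symm ▸ hm, _, hdbl v h hh, ?_⟩
        rw [midpt_comm]
        exact GridAdj.symm _ _ (gridAdj_double_midpt (GridAdj.symm _ _ hgh))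
    have hbcadj : ∃ g ∈ R' b, ∃ h ∈ R' c, GridAdj g h := by
      refine ⟨midpt y r, hR'b ▸ Or.inl rfl, _, hdbl c r hr, ?_⟩
      rw [midpt_comm]
      exact GridAdj.symm _ _ (gridAdj_double_midpt (GridAdj.symm _ _ hyr))
    have hswap : ∀ u v, (∃ g ∈ R' u, ∃ h ∈ R' v, GridAdj g h) →
        ∃ g ∈ R' v, ∃ h ∈ R' u, GridAdj g h := by
      rintro u v ⟨g, hg, h, hh, hgh⟩
      exact ⟨h, hh, g, hg, GridAdj.symm _ _ hgh⟩
    have hsubfin : ∀ w, (subdivision (R w)).Finite := fun w =>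
      (finite_setOf_ends (hR.finite w)).subset fun m hm => Or.inl hm.2.1
    refine ⟨fun w => ?_, fun w => ?_, fun w => ?_, fun u v x hu hv => ?_, fun u v huv => ?_⟩
    · rcases hcases w with rfl | rfl | hw
      · rw [hR'b]; exact ((hsubfin _).subset hMb).insert _
      · rw [hR'c]; exact (hsubfin _).subset hMc
      · rw [hR'w w hw]
        exact (finite_setOf_ends (hR.finite w)).subset fun m hm => hm.2.imp id And.left
    · obtain ⟨g, hg⟩ := hR.nonempty w
      exact ⟨_, hdbl w g hg⟩
    · rcases hcases w with rfl | rfl | hw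
      · rw [hR'b]
        exact hlb.insert_adj GridAdj.symm (hbM y hy) (gridAdj_double_midpt hyr)
      · rw [hR'c]; exact hlc
      · rw [hR'w w hw]; exact isLinked_refinedPart (hR.linked w) (hR.nonempty w)
    · rcases hcases u with rfl | rfl | hu' <;> rcases hcases v with rfl | rfl | hv'
      · rfl
      · exact (hbcdis x hu hv).elim
      · exact (hXT v hv' x hv (hbT x hu)).elim
      · exact (hbcdis x hv hu).elim
      · rfl
      · exact (hXT v hv' x hv (hcT x hu)).elim
      · exact (hXT u hu' x hu (hbT x hv)).elim
      · exact (hXT u hu' x hu (hcT x hv)).elim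
      · rw [hR'w _ hu'] at hu
        rw [hR'w _ hv'] at hv
        exact eq_of_mem_refinedPart hR.eq_of_mem hu' hv' hu hv
    · by_cases hv' : v ∈ X
      · by_cases hu' : u ∈ X
        · simp only [hX, Set.mem_insert_iff, Set.mem_singleton_iff] at hu' hv'
          rcases hu' with rfl | rfl <;> rcases hv' with rfl | rfl
          · exact (huv.ne rfl).elim
          · exact hbcadj
          · exact hswap _ _ hbcadj
          · exact (huv.ne rfl).elim
        · exact hswap _ _ (hadj1 v u huv.symm hu')
      · exact hadj1 u v huv hv'
  obtain ⟨u₀, hu₀⟩ := h₁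
  obtain ⟨v₀, hv₀⟩ := h₂
  have hu₀X : u₀ ∉ X := (hcov u₀).1 (Or.inl hu₀)
  have hv₀X : v₀ ∉ X := (hcov v₀).1 (Or.inr hv₀)
  obtain ⟨g₀, hg₀⟩ := hR.nonempty u₀
  obtain ⟨k₀, hk₀⟩ := hR.nonempty v₀
  have hwalk := hT (double g₀) (hXT u₀ hu₀X _ (hdbl u₀ g₀ hg₀)) (double k₀)
    (hXT v₀ hv₀X _ (hdbl v₀ k₀ hk₀))
  -- follow a chain from the `P₁`-part to the `P₂`-part, keeping what was passed since the last
  -- visit to the `P₁`-part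
  have key : ∀ z, Joined GridAdj (Mb' ∪ Mc)ᶜ (double g₀) z →
      (∃ u ∈ P₁, ∃ D : Set (ℤ × ℤ), D.Finite ∧ (∀ x ∈ D, ∀ w, x ∉ R' w) ∧
        IsLinked GridAdj (R' u ∪ D) ∧ z ∈ R' u ∪ D) ∨
      ∃ u ∈ P₁, ∃ v ∈ P₂, ∃ R', IsGridModel (G ⊔ SimpleGraph.edge u v) R' := by
    intro z hz
    induction hz with
    | refl =>
      exact Or.inl ⟨u₀, hu₀, ∅, Set.finite_empty, by simp, by
        rw [Set.union_empty]; exact hmodel.linked u₀, Or.inl (hdbl u₀ g₀ hg₀)⟩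
    | @tail p q _ hpq ih =>
      obtain ⟨hpq, -, hqT⟩ := hpq
      rcases ih with ⟨u, hu, D, hfin, hD, hl, hp⟩ | ih
      swap
      · exact Or.inr ih
      by_cases hq : ∃ w, q ∈ R' w
      · obtain ⟨w, hw⟩ := hq
        have hwX : w ∉ X := by
          simp only [hX, Set.mem_insert_iff, Set.mem_singleton_iff]
          rintro (rfl | rfl)
          · exact hqT (hbT q hw)
          · exact hqT (hcT q hw)
        rcases (hcov w).2 hwX with h | h
        · exact Or.inl ⟨w, h, ∅, Set.finite_empty, by simp, by
            rw [Set.union_empty]; exact hmodel.linked w, Or.inl hw⟩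
        -- On reaching the second set, the unlabelled points passed since the last visit to the
        -- first set are absorbed into the part of $u$, which becomes adjacent to that of $w$.
        · exact Or.inr ⟨u, hu, w, h, hmodel.sup_edge
            (fun e => Set.disjoint_left.1 hd hu (e ▸ h)) hfin hD hl hp hw hpq⟩
      · push Not at hq
        refine Or.inl ⟨u, hu, insert q D, hfin.insert q, ?_, ?_, Or.inr (Or.inl rfl)⟩
        · rintro x (rfl | hx)
          · exact hq
          · exact hD x hx
        · rw [Set.union_insert]
          exact hl.insert_adj GridAdj.symm hp hpq
  rcases key _ hwalk with ⟨u, hu, D, -, hD, -, hk | hk⟩ | h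
  · have := hmodel.eq_of_mem _ _ _ hk (hdbl v₀ k₀ hk₀)
    exact (Set.disjoint_left.1 hd hu (this ▸ hv₀)).elim
  · exact (hD _ hk v₀ (hdbl v₀ k₀ hk₀)).elim
  · exact h

end CliqueHierarchy
-- Separating triangles of maximal planar graphs
namespace CliqueHierarchy

variable {V : Type*} {G : SimpleGraph V}

/-- The ends of an edge of a maximal planar graph do not separate it. -/
theorem IsMaximalPlanar.exists_adj_of_edge [Finite V] (hG : IsMaximalPlanar G) {b c : V}
    (hbc : G.Adj b c) {P₁ P₂ : Set V} (h₁ : P₁.Nonempty) (h₂ : P₂.Nonempty)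
    (hd : Disjoint P₁ P₂) (hcov : ∀ v, v ∈ P₁ ∨ v ∈ P₂ ↔ v ∉ ({b, c} : Set V)) :
    ∃ u ∈ P₁, ∃ v ∈ P₂, G.Adj u v := by
  obtain ⟨R, hR⟩ := hG.1.exists_isGridModel
  obtain ⟨u, hu, v, hv, R', hR'⟩ := hR.exists_add_edge hbc h₁ h₂ hd hcov
  refine ⟨u, hu, v, hv, by_contra fun huv => ?_⟩
  have hne : u ≠ v := fun h => Set.disjoint_left.1 hd hu (h ▸ hv)
  -- The graph with the extra edge is still a grid minor and hence planar, so by maximality the edge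
  -- was already present.
  refine hG.2 _ (lt_of_le_of_ne le_sup_left fun h => huv ?_) hR'.isPlanar
  rw [h, SimpleGraph.sup_adj, SimpleGraph.edge_adj]
  exact Or.inr ⟨Or.inl ⟨rfl, rfl⟩, hne⟩

/-- A minor of a grid minor is a grid minor. -/
theorem IsGridModel.minor [Finite V] {R : V → Set (ℤ × ℤ)} (hR : IsGridModel G R) {W : Type*}
    {H : SimpleGraph W} {B : W → Set V} (hne : ∀ i, (B i).Nonempty)
    (hl : ∀ i, IsLinked G.Adj (B i)) (hd : ∀ i j u, u ∈ B i → u ∈ B j → i = j)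
    (hadj : ∀ i j, H.Adj i j → ∃ u ∈ B i, ∃ v ∈ B j, G.Adj u v) :
    IsGridModel H fun i => ⋃ u ∈ B i, R u := by
  have hmem : ∀ {i u x}, u ∈ B i → x ∈ R u → x ∈ ⋃ u ∈ B i, R u := fun hu hx =>
    Set.mem_biUnion hu hx
  refine ⟨fun i => (Set.toFinite (B i)).biUnion fun u _ => hR.finite u, fun i => ?_, fun i => ?_,
    fun i j x hi hj => ?_, fun i j hij => ?_⟩
  · obtain ⟨u, hu⟩ := hne i
    obtain ⟨x, hx⟩ := hR.nonempty u
    exact ⟨x, hmem hu hx⟩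
  · intro x hx y hy
    obtain ⟨u, hu, hx⟩ := Set.mem_iUnion₂.1 hx
    obtain ⟨v, hv, hy⟩ := Set.mem_iUnion₂.1 hy
    have hin : ∀ w ∈ B i, ∀ p ∈ R w, ∀ q ∈ R w, Joined GridAdj (⋃ u ∈ B i, R u) p q :=
      fun w hw p hp q hq => (hR.linked w p hp q hq).mono fun z hz => hmem hw hz
    have key : ∀ w, Joined G.Adj (B i) u w → ∀ z ∈ R w,
        Joined GridAdj (⋃ u ∈ B i, R u) x z := by
      intro w hw
      induction hw with
      | refl => exact fun z hz => hin u hu x hx z hz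
      | @tail a b _ hab ih =>
        intro z hz
        obtain ⟨g, hg, h, hh, hgh⟩ := hR.exists_adj a b hab.1
        exact ((ih g hg).trans (Joined.single hgh (hmem hab.2.1 hg) (hmem hab.2.2 hh))).trans
          (hin b hab.2.2 h hh z hz)
    exact key v (hl i u hu v hv) y hy
  · obtain ⟨u, hu, hi⟩ := Set.mem_iUnion₂.1 hi
    obtain ⟨v, hv, hj⟩ := Set.mem_iUnion₂.1 hj
    exact hd i j u hu (hR.eq_of_mem u v x hi hj ▸ hv)
  · obtain ⟨u, hu, v, hv, huv⟩ := hadj i j hij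
    obtain ⟨g, hg, h, hh, hgh⟩ := hR.exists_adj u v huv
    exact ⟨g, hmem hu hg, h, hmem hv hh, hgh⟩

/-- Three vertices together with three disjoint linked sets adjacent to all of them do not exist
in a finite planar graph. -/
theorem IsPlanar.false_of_branch_sets [Finite V] (hG : IsPlanar G) {a b c : V} (hab : a ≠ b)
    (hac : a ≠ c) (hbc : b ≠ c) {C₁ C₂ C₃ : Set V} (l₁ : IsLinked G.Adj C₁)
    (l₂ : IsLinked G.Adj C₂) (l₃ : IsLinked G.Adj C₃) (d₁₂ : Disjoint C₁ C₂)
    (d₁₃ : Disjoint C₁ C₃) (d₂₃ : Disjoint C₂ C₃)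
    (h₁ : ∀ v, v = a ∨ v = b ∨ v = c → v ∉ C₁ ∧ ∃ w ∈ C₁, G.Adj v w)
    (h₂ : ∀ v, v = a ∨ v = b ∨ v = c → v ∉ C₂ ∧ ∃ w ∈ C₂, G.Adj v w)
    (h₃ : ∀ v, v = a ∨ v = b ∨ v = c → v ∉ C₃ ∧ ∃ w ∈ C₃, G.Adj v w) : False := by
  obtain ⟨R, hR⟩ := hG.exists_isGridModel
  -- Contracting the three sets gives $K_{3,3}$, with 0, 1, 2 as the given vertices and 3, 4, 5 as
  -- the branch sets.
  let H : SimpleGraph (Fin 6) :=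
    { Adj := fun i j => (i < 3 ∧ 3 ≤ j) ∨ (j < 3 ∧ 3 ≤ i)
      symm := ⟨fun i j h => h.symm⟩
      loopless := ⟨fun i h => by omega⟩ }
  let B : Fin 6 → Set V := ![{a}, {b}, {c}, C₁, C₂, C₃]
  have hor : ∀ i : Fin 6, i < 3 → ∃ v, B i = {v} ∧ (v = a ∨ v = b ∨ v = c) := by
    intro i hi
    fin_cases i
    · exact ⟨a, rfl, by simp⟩
    · exact ⟨b, rfl, by simp⟩
    · exact ⟨c, rfl, by simp⟩
    all_goals exact absurd hi (by decide)
  have hor' : ∀ i : Fin 6, 3 ≤ i → IsLinked G.Adj (B i) ∧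
      ∀ v, v = a ∨ v = b ∨ v = c → v ∉ B i ∧ ∃ w ∈ B i, G.Adj v w := by
    intro i hi
    fin_cases i
    iterate 3 exact absurd hi (by decide)
    · exact ⟨l₁, h₁⟩
    · exact ⟨l₂, h₂⟩
    · exact ⟨l₃, h₃⟩
  have hcr : ∀ i j : Fin 6, i < 3 → 3 ≤ j → ∃ u ∈ B i, ∃ v ∈ B j, G.Adj u v := by
    intro i j hi hj
    obtain ⟨v, hv, hv'⟩ := hor i hi
    obtain ⟨w, hw, hvw⟩ := ((hor' j hj).2 v hv').2
    exact ⟨v, hv ▸ rfl, w, hw, hvw⟩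
  have hmodel : IsGridModel H fun i => ⋃ u ∈ B i, R u := by
    refine hR.minor (fun i => ?_) (fun i => ?_) ?_ ?_
    · rcases lt_or_ge i 3 with hi | hi
      · obtain ⟨v, hv, -⟩ := hor i hi
        exact hv ▸ Set.singleton_nonempty v
      · obtain ⟨w, hw, -⟩ := ((hor' i hi).2 a (Or.inl rfl)).2
        exact ⟨w, hw⟩
    · rcases lt_or_ge i 3 with hi | hi
      · obtain ⟨v, hv, -⟩ := hor i hi
        exact hv ▸ isLinked_singleton
      · exact (hor' i hi).1
    · have key : ∀ i j : Fin 6, i < j → Disjoint (B i) (B j) := by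
        intro i j hij
        rcases lt_or_ge j 3 with hj | hj
        · fin_cases i <;> fin_cases j <;> first
            | exact absurd hij (by decide)
            | exact absurd hj (by decide)
            | exact Set.disjoint_singleton.2 hab
            | exact Set.disjoint_singleton.2 hac
            | exact Set.disjoint_singleton.2 hbc
        rcases lt_or_ge i 3 with hi | hi
        · obtain ⟨v, hv, hv'⟩ := hor i hi
          rw [hv, Set.disjoint_singleton_left]
          exact ((hor' j hj).2 v hv').1
        · fin_cases i <;> fin_cases j <;> first
            | exact absurd hij (by decide)
            | exact absurd hi (by decide)
            | assumption
      intro i j u hi hj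
      by_contra hij
      rcases lt_or_gt_of_ne hij with h | h
      · exact Set.disjoint_left.1 (key i j h) hi hj
      · exact Set.disjoint_left.1 (key j i h) hj hi
    · rintro i j (⟨hi, hj⟩ | ⟨hj, hi⟩)
      · exact hcr i j hi hj
      · obtain ⟨u, hu, v, hv, huv⟩ := hcr j i hj hi
        exact ⟨v, hv, u, hu, huv.symm⟩
  obtain ⟨D⟩ := hmodel.isPlanar
  have hH : ∀ i j : Fin 6, i < 3 → 3 ≤ j → H.Adj i j := fun i j hi hj => Or.inl ⟨hi, hj⟩
  exact D.false_of_K33 (a := 0) (b := 1) (c := 2) (d := 3) (e := 4) (f := 5) (by decide)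
    (by decide) (by decide) (by decide) (by decide) (hH _ _ (by decide) (by decide))
    (hH _ _ (by decide) (by decide)) (hH _ _ (by decide) (by decide))
    (hH _ _ (by decide) (by decide)) (hH _ _ (by decide) (by decide))
    (hH _ _ (by decide) (by decide)) (hH _ _ (by decide) (by decide))
    (hH _ _ (by decide) (by decide)) (hH _ _ (by decide) (by decide))

/-- The sets `S` and `S'` partition the complement of `k`, are not empty and are not joined by an
edge. -/
structure Separates (G : SimpleGraph V) (k : ThreeClique G) (S S' : Set V) : Prop where
  mem_or : ∀ v, v ∈ S ∨ v ∈ k.1 ∨ v ∈ S'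
  not_mem_left : ∀ v ∈ k.1, v ∉ S
  not_mem_right : ∀ v ∈ k.1, v ∉ S'
  disjoint : Disjoint S S'
  not_adj : ∀ u ∈ S, ∀ v ∈ S', ¬ G.Adj u v
  nonempty_left : S.Nonempty
  nonempty_right : S'.Nonempty

section
variable {k : ThreeClique G} {S S' : Set V}

theorem Separates.symm (h : Separates G k S S') : Separates G k S' S :=
  ⟨fun v => by have := h.mem_or v; tauto, h.not_mem_right, h.not_mem_left, h.disjoint.symm,
    fun u hu v hv huv => h.not_adj v hv u hu huv.symm, h.nonempty_right, h.nonempty_left⟩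

theorem ThreeClique.exists_eq {k : ThreeClique G} {v : V} (hv : v ∈ k.1) :
    ∃ b c, G.Adj v b ∧ G.Adj v c ∧ G.Adj b c ∧ ∀ w, w ∈ k.1 ↔ w = v ∨ w = b ∨ w = c := by
  classical
  obtain ⟨x, y, z, hxy, hxz, hyz, hk⟩ := SimpleGraph.is3Clique_iff.1 k.2
  have hmem : ∀ w, w ∈ k.1 ↔ w = x ∨ w = y ∨ w = z := fun w => by rw [hk]; simp
  rcases (hmem v).1 hv with rfl | rfl | rfl
  · exact ⟨y, z, hxy, hxz, hyz, hmem⟩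
  · exact ⟨x, z, hxy.symm, hyz, hxz, fun w => by rw [hmem]; tauto⟩
  · exact ⟨x, y, hxz.symm, hyz.symm, hxy, fun w => by rw [hmem]; tauto⟩

/-- Every vertex of a separating triangle has neighbours on both sides. -/
theorem Separates.exists_adj [Finite V] (hG : IsMaximalPlanar G) (h : Separates G k S S') {v : V}
    (hv : v ∈ k.1) : ∃ w ∈ S, G.Adj v w := by
  obtain ⟨b, c, hvb, hvc, hbc, hk⟩ := ThreeClique.exists_eq hv
  -- Were $v$ without neighbours in $S$, the other two vertices of the triangle would separate $S$
  -- from $S'\cup\{v\}$. The edge found between these sets cannot end in $S'$, so it ends in $v$.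
  obtain ⟨u, hu, w, hw, huw⟩ := hG.exists_adj_of_edge hbc (P₁ := S) (P₂ := insert v S')
    h.nonempty_left (Set.insert_nonempty _ _) (by
      rw [Set.disjoint_insert_right]
      exact ⟨h.not_mem_left v hv, h.disjoint⟩) (fun w => by
      have h1 := h.mem_or w
      have h2 := h.not_mem_left w
      have h3 := h.not_mem_right w
      have h4 := hvb.ne
      have h5 := hvc.ne
      rw [hk] at h1 h2 h3
      simp only [Set.mem_insert_iff, Set.mem_singleton_iff]
      by_cases hwv : w = v
      · subst hwv; tauto
      · tauto)
  rcases hw with rfl | hw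
  · exact ⟨u, hu, huw.symm⟩
  · exact (h.not_adj u hu w hw huw).elim

/-- A component of one side is itself a side of the triangle, once the rest of that side is moved
across. Thus every component, and not merely the whole side, is adjacent to all three vertices. -/
theorem Separates.component (h : Separates G k S S') {x : V} (hx : x ∈ S) :
    Separates G k {z | Joined G.Adj S x z} (S \ {z | Joined G.Adj S x z} ∪ S') := by
  have hsub : ∀ z, Joined G.Adj S x z → z ∈ S := fun z hz => hz.mem_right hx
  refine ⟨fun v => ?_, fun v hv hv' => h.not_mem_left v hv (hsub v hv'), ?_, ?_, ?_,
    ⟨x, Relation.ReflTransGen.refl⟩, h.nonempty_right.mono Set.subset_union_right⟩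
  · have := h.mem_or v
    simp only [Set.mem_union, Set.mem_sdiff, Set.mem_ofPred_eq]
    tauto
  · rintro v hv (hv' | hv')
    · exact h.not_mem_left v hv hv'.1
    · exact h.not_mem_right v hv hv'
  · rw [Set.disjoint_left]
    rintro z hz (hz' | hz')
    · exact hz'.2 hz
    · exact Set.disjoint_left.1 h.disjoint (hsub z hz) hz'
  · rintro u hu v (hv | hv) huv
    · exact hv.2 (hu.trans (Joined.single huv (hsub u hu) hv.1))
    · exact h.not_adj u (hsub u hu) v hv huv

/-- The sides of a separating triangle are connected. -/
theorem Separates.isLinked [Finite V] (hG : IsMaximalPlanar G) (h : Separates G k S S') :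
    IsLinked G.Adj S := by
  intro x hx y hy
  by_contra hxy
  obtain ⟨z, hz⟩ := h.nonempty_right
  obtain ⟨a, ha⟩ : k.1.Nonempty := Finset.card_pos.1 (by rw [k.2.card_eq]; norm_num)
  obtain ⟨b, c, hab, hac, hbc, hk⟩ := ThreeClique.exists_eq ha
  have hr : ∀ a b, G.Adj a b → G.Adj b a := fun _ _ h => h.symm
  have key : ∀ {S S' : Set V} {x : V}, Separates G k S S' → x ∈ S → ∀ v, v = a ∨ v = b ∨ v = c →
      v ∉ {z | Joined G.Adj S x z} ∧ ∃ w ∈ {z | Joined G.Adj S x z}, G.Adj v w :=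
    fun h hx v hv => ⟨(h.component hx).not_mem_left v ((hk v).2 hv),
      (h.component hx).exists_adj hG ((hk v).2 hv)⟩
  -- The three branch sets are the components of $x$ and $y$ in $S$ and the component of $z$ in
  -- $S'$.
  refine hG.1.false_of_branch_sets hab.ne hac.ne hbc.ne (isLinked_setOf_joined hr)
    (isLinked_setOf_joined hr) (isLinked_setOf_joined hr) ?_ ?_ ?_ (key h hx) (key h hy)
    (key h.symm hz)
  · exact Set.disjoint_left.2 fun w hw hw' => hxy (Joined.trans hw (Joined.symm hr hw'))
  · exact Set.disjoint_left.2 fun w hw hw' => Set.disjoint_left.1 h.disjoint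
      (Joined.mem_right hw hx) (Joined.mem_right hw' hz)
  · exact Set.disjoint_left.2 fun w hw hw' => Set.disjoint_left.1 h.disjoint
      (Joined.mem_right hw hy) (Joined.mem_right hw' hz)

theorem Separates.subset_or (h : Separates G k S S') {T : Set V} (hT : IsLinked G.Adj T)
    (hk : ∀ v ∈ k.1, v ∉ T) : T ⊆ S ∨ T ⊆ S' := by
  have key : ∀ {S S'}, Separates G k S S' → ∀ x ∈ T, x ∈ S → T ⊆ S := by
    intro S S' h x hx hxS y hy
    induction hT x hx y hy with
    | refl => exact hxS
    | @tail a b _ hab ih =>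
      rcases h.mem_or b with hb | hb | hb
      · exact hb
      · exact (hk b hb hab.2.2).elim
      · exact (h.not_adj a (ih hab.2.1) b hb hab.1).elim
  rcases T.eq_empty_or_nonempty with rfl | ⟨x, hx⟩
  · exact Or.inl (Set.empty_subset _)
  · rcases h.mem_or x with hx' | hx' | hx'
    · exact Or.inl (key h x hx hx')
    · exact (hk x hx' hx).elim
    · exact Or.inr (key h.symm x hx hx')

theorem Separates.clique_subset_or (h : Separates G k S S') (k' : ThreeClique G) :
    (∀ v ∈ k'.1, v ∉ S') ∨ ∀ v ∈ k'.1, v ∉ S := by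
  by_contra! hcon
  obtain ⟨⟨v, hv, hvS⟩, w, hw, hwS⟩ := hcon
  exact h.not_adj w hwS v hvS (k'.2.isClique hw hv fun e =>
    Set.disjoint_left.1 h.disjoint hwS (e ▸ hvS))

end

theorem ThreeClique.eq_of_subset {k k' : ThreeClique G} (h : ∀ v ∈ k.1, v ∈ k'.1) : k = k' :=
  Subtype.ext (Finset.eq_of_subset_of_card_le h (by rw [k.2.card_eq, k'.2.card_eq]))

/-- A nonempty interior forces the other side to be nonempty by the comparison of orders. Paths of
length one show that no edge joins the sides. -/
theorem InteriorChoice.exists_separates [Finite V] (I : InteriorChoice G) {k : ThreeClique G}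
    (hne : (I.interior k).Nonempty) :
    ∃ S', Separates G k (I.interior k) S' ∧ (I.interior k).ncard ≤ S'.ncard := by
  obtain ⟨S', ⟨hdiv, -⟩, hcard⟩ := I.isInterior k
  refine ⟨S', ⟨fun v => ?_, fun v hv hv' => Set.disjoint_left.1 hdiv.disjoint_left hv' hv,
    fun v hv hv' => Set.disjoint_left.1 hdiv.disjoint_right hv' hv, hdiv.disjoint, ?_, hne, ?_⟩,
    hcard⟩
  · have : v ∈ I.interior k ∪ (k.1 : Set V) ∪ S' := hdiv.cover ▸ Set.mem_univ v
    simpa [or_assoc] using this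
  · intro u hu v hv huv
    obtain ⟨w, hw, hwk⟩ := hdiv.path_meets u hu v hv huv.toWalk (SimpleGraph.Walk.IsPath.of_adj huv)
    simp only [SimpleGraph.Walk.support_cons, SimpleGraph.Walk.support_nil, List.mem_cons,
      List.not_mem_nil, or_false] at hw
    rcases hw with rfl | rfl
    · exact Set.disjoint_left.1 hdiv.disjoint_left hu hwk
    · exact Set.disjoint_left.1 hdiv.disjoint_right hv hwk
  · exact (Set.ncard_pos (Set.toFinite _)).1 (((Set.ncard_pos (Set.toFinite _)).2 hne).trans_le hcard)

theorem below_of_subset {I : InteriorChoice G} {k k' : ThreeClique G} {S S' : Set V}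
    (h : Separates G k (I.interior k) S) (h' : Separates G k' (I.interior k') S') (hs : S' ⊆ S) :
    Below I k k' := by
  rintro v hv
  rcases h'.mem_or v with hv' | hv' | hv'
  · exact Or.inr hv'
  · exact Or.inl hv'
  · rcases hv with hv | hv
    · exact (h.not_mem_right v hv (hs hv')).elim
    · exact (Set.disjoint_left.1 h.disjoint hv (hs hv')).elim

/-- If the triangle `x'` does not enter the exterior of `x`, then `x` and `x'` are comparable. -/
theorem below_of_disjoint_exterior [Finite V] (hG : IsMaximalPlanar G) {I : InteriorChoice G}
    {x x' : ThreeClique G} {S S' : Set V} (h : Separates G x (I.interior x) S)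
    (h' : Separates G x' (I.interior x') S') (hc : (I.interior x).ncard ≤ S.ncard)
    (hc' : (I.interior x').ncard ≤ S'.ncard) (hd : ∀ v ∈ x'.1, v ∉ S) :
    Below I x' x ∨ x = x' := by
  rcases h'.subset_or (h.symm.isLinked hG) hd with hs | hs
  · right
    have hx : ∀ v ∈ x.1, v ∉ S' := by
      intro v hv hv'
      -- A vertex of $x$ has a neighbour in the exterior of $x$, here inside the interior of $x'$,
      -- so it cannot lie in the exterior of $x'$.
      obtain ⟨w, hw, hvw⟩ := h.symm.exists_adj hG hv
      exact h'.not_adj w (hs hw) v hv' hvw.symm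
    have hs' : S' ⊆ I.interior x := by
      intro v hv
      rcases h.mem_or v with hv' | hv' | hv'
      · exact hv'
      · exact (hx v hv' hv).elim
      · exact (Set.disjoint_left.1 h'.disjoint (hs hv') hv).elim
    -- Now $|S|\le|I(x')|\le|S'|\le|I(x)|\le|S|$ with $I$ the interior, so both inclusions are
    -- equalities and the two triangles have the same complement.
    have c1 := Set.ncard_le_ncard hs
    have c2 := Set.ncard_le_ncard hs'
    have e1 : S = I.interior x' := Set.eq_of_subset_of_ncard_le hs (by omega)
    have e2 : S' = I.interior x := Set.eq_of_subset_of_ncard_le hs' (by omega)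
    refine ThreeClique.eq_of_subset fun v hv => ?_
    rcases h'.mem_or v with hv' | hv' | hv'
    · exact (h.not_mem_right v hv (e1 ▸ hv')).elim
    · exact hv'
    · exact (hx v hv hv').elim
  · exact Or.inl (below_of_subset h' h hs)

/-- Distinct covers are incomparable, so by `below_of_disjoint_exterior` each must enter the
exterior of the other and hence, being a clique, avoid its interior. Connectedness then places the
interior of $x$ on one side of $x'$, and both possibilities are absurd. -/
theorem Covers.unique [Finite V] (hG : IsMaximalPlanar G) {I : InteriorChoice G}
    {x x' y : ThreeClique G} (hx : Covers I x y) (hx' : Covers I x' y) : x = x' := by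
  by_contra hne
  have b1 : ¬ Below I x x' := fun h => hx'.2.2 ⟨x, hne, hx.2.1.symm, hx.1, h⟩
  have b2 : ¬ Below I x' x := fun h => hx.2.2 ⟨x', Ne.symm hne, hx'.2.1.symm, hx'.1, h⟩
  have hint : ∀ {x}, Covers I x y → (I.interior x).Nonempty := by
    intro x hx
    by_contra he
    rw [Set.not_nonempty_iff_eq_empty] at he
    refine hx.2.1 (ThreeClique.eq_of_subset fun v hv => ?_)
    have := hx.1 (Or.inl hv)
    rwa [he, Set.union_empty] at this
  obtain ⟨S, h, hc⟩ := I.exists_separates (hint hx)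
  obtain ⟨S', h', hc'⟩ := I.exists_separates (hint hx')
  rcases h.clique_subset_or x' with h1 | h1
  · rcases below_of_disjoint_exterior hG h h' hc hc' h1 with h2 | h2
    · exact b2 h2
    · exact hne h2
  rcases h'.clique_subset_or x with h2 | h2
  · rcases below_of_disjoint_exterior hG h' h hc' hc h2 with h3 | h3
    · exact b1 h3
    · exact hne h3.symm
  rcases h'.subset_or (h.isLinked hG) h1 with hs | hs
  -- Interior inside interior: each vertex of $x$ has a neighbour in the interior of $x'$, so it is
  -- not in the exterior; nor is it in the interior, so it lies in $x'$.
  · refine hne (ThreeClique.eq_of_subset fun v hv => ?_)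
    rcases h'.mem_or v with hv' | hv' | hv'
    · exact (h2 v hv hv').elim
    · exact hv'
    · obtain ⟨w, hw, hvw⟩ := h.exists_adj hG hv
      exact (h'.not_adj w (hs hw) v hv' hvw.symm).elim
  -- Disjoint interiors: a vertex of $y$ in the interior of $x$ would be in the exterior of $x'$,
  -- against $y\preceq x'$. So $y$ is contained in $x$ and equals it.
  · refine hx.2.1 (ThreeClique.eq_of_subset fun v hv => ?_)
    rcases hx.1 (Or.inl hv) with hv1 | hv1
    · exact hv1
    · rcases hx'.1 (Or.inl hv) with hv2 | hv2
      · exact (h'.not_mem_right v hv2 (hs hv1)).elim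
      · exact (Set.disjoint_left.1 h'.disjoint hv2 (hs hv1)).elim

theorem encard_outgoingEdges_le_one [Finite V] (hG : IsMaximalPlanar G) (I : InteriorChoice G)
    (k : ThreeClique G) : (outgoingEdges (hierarchicalGraph I) k).encard ≤ 1 := by
  rw [Set.encard_le_one_iff]
  rintro ⟨a, x⟩ ⟨b, x'⟩ ⟨h1, rfl⟩ ⟨h2, h3⟩
  simp only at h3
  subst h3
  exact congrArg _ (Covers.unique hG h1 h2)

end CliqueHierarchy
-- A triangle with three incoming edges
namespace CliqueHierarchy

/-- The complete graph on five vertices without the edge between `3` and `4`. -/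
def bipyramid : SimpleGraph (Fin 5) where
  Adj i j := i ≠ j ∧ ¬ (i = 3 ∧ j = 4) ∧ ¬ (i = 4 ∧ j = 3)
  symm := ⟨fun _ _ h => ⟨h.1.symm, fun h' => h.2.2 h'.symm, fun h' => h.2.1 h'.symm⟩⟩
  loopless := ⟨fun _ h => h.1 rfl⟩

theorem bipyramid_adj {i j : Fin 5} :
    bipyramid.Adj i j ↔ i ≠ j ∧ ¬ (i = 3 ∧ j = 4) ∧ ¬ (i = 4 ∧ j = 3) := Iff.rfl

/-- The vertices of the bipyramid as sets of grid points. -/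
def bipyramidModel : Fin 5 → Set (ℤ × ℤ) :=
  ![{(1, 1), (1, -1), (1, 0)}, {(0, 1)}, {(0, -1), (-1, -1), (-1, 1), (-1, 0)}, {(0, 0)},
    {(2, 0), (2, 1), (2, 2), (1, 2), (0, 2), (-1, 2), (-2, 2), (-2, 1), (-2, 0)}]

theorem isGridModel_bipyramid : IsGridModel bipyramid bipyramidModel := by
  have hs : ∀ {s : Set (ℤ × ℤ)} {x y : ℤ × ℤ}, IsLinked GridAdj s → x ∈ s → GridAdj x y →
      IsLinked GridAdj (insert y s) := fun h hx hxy => h.insert_adj GridAdj.symm hx hxy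
  refine ⟨fun v => ?_, fun v => ?_, fun v => ?_, fun u v x hu hv => ?_, fun u v huv => ?_⟩
  · fin_cases v <;> simp [bipyramidModel]
  · fin_cases v <;> simp [bipyramidModel]
  · fin_cases v
    · exact hs (x := (1, 0)) (hs (x := (1, 0)) isLinked_singleton (by simp) (by simp [GridAdj]))
        (by simp) (by simp [GridAdj])
    · exact isLinked_singleton
    · exact hs (x := (-1, -1)) (hs (x := (-1, 0)) (hs (x := (-1, 0)) isLinked_singleton (by simp)
        (by simp [GridAdj])) (by simp) (by simp [GridAdj])) (by simp) (by simp [GridAdj])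
    · exact isLinked_singleton
    · exact hs (x := (2, 1)) (hs (x := (2, 2)) (hs (x := (1, 2)) (hs (x := (0, 2))
        (hs (x := (-1, 2)) (hs (x := (-2, 2)) (hs (x := (-2, 1)) (hs (x := (-2, 0))
        isLinked_singleton (by simp) (by simp [GridAdj])) (by simp) (by simp [GridAdj]))
        (by simp) (by simp [GridAdj])) (by simp) (by simp [GridAdj])) (by simp)
        (by simp [GridAdj])) (by simp) (by simp [GridAdj])) (by simp) (by simp [GridAdj]))
        (by simp) (by simp [GridAdj])
  · obtain ⟨p, q⟩ := x
    fin_cases u <;> fin_cases v <;> first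
      | rfl
      | (exfalso; simp [bipyramidModel] at hu hv; omega)
  · have key : ∀ u v : Fin 5, u < v → bipyramid.Adj u v →
        ∃ g ∈ bipyramidModel u, ∃ h ∈ bipyramidModel v, GridAdj g h := by
      intro u v hlt huv
      have e : ∀ (u v : Fin 5) (g h : ℤ × ℤ), GridAdj g h → g ∈ bipyramidModel u →
          h ∈ bipyramidModel v → ∃ g ∈ bipyramidModel u, ∃ h ∈ bipyramidModel v, GridAdj g h :=
        fun _ _ g h hgh hg hh => ⟨g, hg, h, hh, hgh⟩
      have e01 := e 0 1 (1, 1) (0, 1) (by simp [GridAdj]) (by simp [bipyramidModel])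
        (by simp [bipyramidModel])
      have e02 := e 0 2 (1, -1) (0, -1) (by simp [GridAdj]) (by simp [bipyramidModel])
        (by simp [bipyramidModel])
      have e03 := e 0 3 (1, 0) (0, 0) (by simp [GridAdj]) (by simp [bipyramidModel])
        (by simp [bipyramidModel])
      have e04 := e 0 4 (1, 0) (2, 0) (by simp [GridAdj]) (by simp [bipyramidModel])
        (by simp [bipyramidModel])
      have e12 := e 1 2 (0, 1) (-1, 1) (by simp [GridAdj]) (by simp [bipyramidModel])
        (by simp [bipyramidModel])
      have e13 := e 1 3 (0, 1) (0, 0) (by simp [GridAdj]) (by simp [bipyramidModel])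
        (by simp [bipyramidModel])
      have e14 := e 1 4 (0, 1) (0, 2) (by simp [GridAdj]) (by simp [bipyramidModel])
        (by simp [bipyramidModel])
      have e23 := e 2 3 (-1, 0) (0, 0) (by simp [GridAdj]) (by simp [bipyramidModel])
        (by simp [bipyramidModel])
      have e24 := e 2 4 (-1, 0) (-2, 0) (by simp [GridAdj]) (by simp [bipyramidModel])
        (by simp [bipyramidModel])
      fin_cases u <;> fin_cases v <;> first
        | exact absurd hlt (by decide)
        | exact (huv.2.1 ⟨rfl, rfl⟩).elim
        | exact e01
        | exact e02
        | exact e03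
        | exact e04
        | exact e12
        | exact e13
        | exact e14
        | exact e23
        | exact e24
    rcases lt_or_gt_of_ne huv.ne with h | h
    · exact key u v h huv
    · obtain ⟨g, hg, k, hk, hgk⟩ := key v u h huv.symm
      exact ⟨k, hk, g, hg, GridAdj.symm _ _ hgk⟩

theorem isMaximalPlanar_bipyramid : IsMaximalPlanar bipyramid := by
  refine ⟨isGridModel_bipyramid.isPlanar, ?_⟩
  rintro G' hlt ⟨D⟩
  -- A proper supergraph can only gain the missing edge, which makes it $K_5$.
  have h34 : G'.Adj 3 4 := by
    by_contra hcon
    refine hlt.not_ge fun u v huv => ⟨huv.ne, ?_, ?_⟩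
    · rintro ⟨rfl, rfl⟩; exact hcon huv
    · rintro ⟨rfl, rfl⟩; exact hcon huv.symm
  have h : ∀ i j : Fin 5, i ≠ j → G'.Adj i j := by
    intro i j hij
    by_cases h1 : i = 3 ∧ j = 4
    · rw [h1.1, h1.2]; exact h34
    by_cases h2 : i = 4 ∧ j = 3
    · rw [h2.1, h2.2]; exact h34.symm
    · exact hlt.le ⟨hij, h1, h2⟩
  exact D.false_of_K5 (a := 0) (b := 1) (c := 2) (d := 3) (e := 4) (by decide) (by decide)
    (by decide) (by decide) (h _ _ (by decide)) (h _ _ (by decide)) (h _ _ (by decide))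
    (h _ _ (by decide)) (h _ _ (by decide)) (h _ _ (by decide)) (h _ _ (by decide))
    (h _ _ (by decide)) (h _ _ (by decide)) (h _ _ (by decide))

theorem exists_mem_support_of_not_adj {V : Type*} {G : SimpleGraph V} {S S' K : Set V}
    (hcov : ∀ v, v ∈ S ∨ v ∈ K ∨ v ∈ S') (hd : Disjoint S S')
    (hna : ∀ u ∈ S, ∀ v ∈ S', ¬ G.Adj u v) {i j : V} (p : G.Walk i j) (hi : i ∈ S) (hj : j ∈ S') :
    ∃ v ∈ p.support, v ∈ K := by
  induction p with
  | nil => exact (Set.disjoint_left.1 hd hi hj).elim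
  | @cons u v w h p ih =>
    rcases hcov v with hv | hv | hv
    · obtain ⟨x, hx, hxK⟩ := ih hv hj
      exact ⟨x, by simp [hx], hxK⟩
    · exact ⟨v, by simp, hv⟩
    · exact (hna u hi v hv h).elim

/-- Vertices on opposite sides are distinct and nonadjacent, and 3, 4 is the only such pair; the
triangle avoids both. -/
theorem bipyramid_eq_of_isSeparating {k : ThreeClique bipyramid} (h : IsSeparating bipyramid k) :
    k.1 = {0, 1, 2} := by
  obtain ⟨S, S', hdiv, ⟨i, hi⟩, j, hj⟩ := h
  have hik : i ∉ k.1 := Set.disjoint_left.1 hdiv.disjoint_left hi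
  have hjk : j ∉ k.1 := Set.disjoint_left.1 hdiv.disjoint_right hj
  have hij : ¬ bipyramid.Adj i j := by
    intro h
    obtain ⟨w, hw, hwk⟩ := hdiv.path_meets i hi j hj h.toWalk (SimpleGraph.Walk.IsPath.of_adj h)
    simp only [SimpleGraph.Walk.support_cons, SimpleGraph.Walk.support_nil, List.mem_cons,
      List.not_mem_nil, or_false] at hw
    rcases hw with rfl | rfl
    · exact hik hwk
    · exact hjk hwk
  have hne : i ≠ j := fun h => Set.disjoint_left.1 hdiv.disjoint hi (h ▸ hj)
  have h34 : 3 ∉ k.1 ∧ 4 ∉ k.1 := by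
    rw [bipyramid_adj] at hij
    by_cases h1 : i = 3 ∧ j = 4
    · rw [← h1.1, ← h1.2]; exact ⟨hik, hjk⟩
    by_cases h2 : i = 4 ∧ j = 3
    · rw [← h2.1, ← h2.2]; exact ⟨hjk, hik⟩
    · exact (hij ⟨hne, h1, h2⟩).elim
  refine Finset.eq_of_subset_of_card_le (fun v hv => ?_) (by rw [k.2.card_eq]; decide)
  fin_cases v
  · simp
  · simp
  · simp
  · exact (h34.1 hv).elim
  · exact (h34.2 hv).elim

/-- The interior of the triangle `0 1 2` of the bipyramid is `3`. -/
def bipyramidInterior : InteriorChoice bipyramid where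
  interior k := if k.1 = {0, 1, 2} then {3} else ∅
  isInterior k := by
    by_cases hk : k.1 = {0, 1, 2}
    · rw [if_pos hk]
      have hcov : ∀ v : Fin 5, v ∈ ({3} : Set (Fin 5)) ∨ v ∈ (k.1 : Set (Fin 5)) ∨
          v ∈ ({4} : Set (Fin 5)) := by
        intro v; rw [hk]; fin_cases v <;> simp
      refine ⟨{4}, ⟨⟨?_, ?_, ?_, ?_, ?_⟩, fun _ => ⟨⟨3, rfl⟩, ⟨4, rfl⟩⟩⟩, by simp⟩
      · rw [hk]; simp
      · rw [hk]; simp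
      · simp
      · refine Set.eq_univ_of_forall fun v => ?_
        have := hcov v
        simp only [Set.mem_union]; tauto
      · intro i hi j hj p _
        refine exists_mem_support_of_not_adj hcov (by simp) ?_ p hi hj
        rintro _ rfl _ rfl h
        exact h.2.1 ⟨rfl, rfl⟩
    · rw [if_neg hk]
      refine ⟨(k.1 : Set (Fin 5))ᶜ, ⟨⟨?_, ?_, ?_, ?_, ?_⟩, fun h =>
        (hk (bipyramid_eq_of_isSeparating h)).elim⟩, by simp⟩
      · simp
      · exact disjoint_compl_left
      · simp
      · simp
      · intro i hi; exact hi.elim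

theorem three_le_encard_incomingEdges_bipyramid :
    ∃ k : ThreeClique bipyramid,
      3 ≤ (incomingEdges (hierarchicalGraph bipyramidInterior) k).encard := by
  have hcl : ∀ a b c : Fin 5, bipyramid.Adj a b → bipyramid.Adj a c → bipyramid.Adj b c →
      bipyramid.IsNClique 3 {a, b, c} := fun a b c h1 h2 h3 =>
    SimpleGraph.is3Clique_iff.2 ⟨a, b, c, h1, h2, h3, rfl⟩
  have hadj : ∀ a b : Fin 5, a ≠ b → b ≠ 4 → a ≠ 4 → bipyramid.Adj a b := fun a b h h1 h2 =>
    ⟨h, fun h' => h1 h'.2, fun h' => h2 h'.1⟩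
  let t : ThreeClique bipyramid := ⟨{0, 1, 2}, hcl 0 1 2 (hadj _ _ (by decide) (by decide)
    (by decide)) (hadj _ _ (by decide) (by decide) (by decide)) (hadj _ _ (by decide) (by decide)
    (by decide))⟩
  have hcov : ∀ y : ThreeClique bipyramid, y.1 ≠ {0, 1, 2} → 4 ∉ y.1 →
      (y, t) ∈ incomingEdges (hierarchicalGraph bipyramidInterior) t := by
    intro y hy h4
    have hint : ∀ z : ThreeClique bipyramid, z.1 ≠ {0, 1, 2} →
        bipyramidInterior.interior z = ∅ := fun z hz => if_neg hz
    refine ⟨⟨?_, fun h => hy (congrArg Subtype.val h), ?_⟩, rfl⟩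
    · intro v hv
      have hv : v ∈ y.1 := by
        rw [hint y hy, Set.union_empty] at hv
        exact hv
      have ht : bipyramidInterior.interior t = {3} :=
      if_pos (e := ∅) (show t.1 = {0, 1, 2} from rfl)
      rw [ht]
      fin_cases v
      · exact Or.inl (by simp [t])
      · exact Or.inl (by simp [t])
      · exact Or.inl (by simp [t])
      · exact Or.inr rfl
      · exact (h4 hv).elim
    -- Every triangle other than $t$ has empty interior, so an intermediate $z$ would contain $y$
    -- and hence equal it.
    · rintro ⟨z, hzt, hzy, hyz, -⟩
      refine hzy (ThreeClique.eq_of_subset fun v hv => ?_).symm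
      have := hyz (Or.inl hv)
      rwa [hint z fun h => hzt (Subtype.ext h), Set.union_empty] at this
  have hy : ∀ a b : Fin 5, a ≠ b → a ≠ 3 → b ≠ 3 → a ≠ 4 → b ≠ 4 →
      bipyramid.IsNClique 3 {a, b, 3} := fun a b hab ha hb ha' hb' =>
    hcl a b 3 (hadj _ _ hab hb' ha') (hadj _ _ ha (by decide) ha') (hadj _ _ hb (by decide) hb')
  let y₁ : ThreeClique bipyramid := ⟨{0, 1, 3}, hy 0 1 (by decide) (by decide) (by decide)
    (by decide) (by decide)⟩
  let y₂ : ThreeClique bipyramid := ⟨{0, 2, 3}, hy 0 2 (by decide) (by decide) (by decide)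
    (by decide) (by decide)⟩
  let y₃ : ThreeClique bipyramid := ⟨{1, 2, 3}, hy 1 2 (by decide) (by decide) (by decide)
    (by decide) (by decide)⟩
  have hne : ∀ y y' : ThreeClique bipyramid, y.1 ≠ y'.1 → (y, t) ≠ (y', t) := fun y y' h h' =>
    h (by rw [(Prod.mk.inj h').1])
  have n₁₂ : ({0, 1, 3} : Finset (Fin 5)) ≠ {0, 2, 3} := by decide
  have n₁₃ : ({0, 1, 3} : Finset (Fin 5)) ≠ {1, 2, 3} := by decide
  have n₂₃ : ({0, 2, 3} : Finset (Fin 5)) ≠ {1, 2, 3} := by decide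
  have m₁ : ({0, 1, 3} : Finset (Fin 5)) ≠ {0, 1, 2} ∧ (4 : Fin 5) ∉ ({0, 1, 3} : Finset _) := by
    decide
  have m₂ : ({0, 2, 3} : Finset (Fin 5)) ≠ {0, 1, 2} ∧ (4 : Fin 5) ∉ ({0, 2, 3} : Finset _) := by
    decide
  have m₃ : ({1, 2, 3} : Finset (Fin 5)) ≠ {0, 1, 2} ∧ (4 : Fin 5) ∉ ({1, 2, 3} : Finset _) := by
    decide
  refine ⟨t, ?_⟩
  have h3 : ({(y₁, t), (y₂, t), (y₃, t)} : Set (ThreeClique bipyramid × ThreeClique bipyramid)).encard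
      = 3 := Set.encard_eq_three.2 ⟨_, _, _, hne y₁ y₂ n₁₂, hne y₁ y₃ n₁₃,
        hne y₂ y₃ n₂₃, rfl⟩
  rw [← h3]
  refine Set.encard_le_encard ?_
  rintro _ (rfl | rfl | rfl)
  · exact hcov y₁ m₁.1 m₁.2
  · exact hcov y₂ m₂.1 m₂.2
  · exact hcov y₃ m₃.1 m₃.2

end CliqueHierarchy

theorem mainTheorem8 :
    (∃ (n : ℕ) (G : SimpleGraph (Fin n)), CliqueHierarchy.IsMaximalPlanar G ∧
      ∃ (I : CliqueHierarchy.InteriorChoice G) (k : CliqueHierarchy.ThreeClique G),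
        3 ≤ (CliqueHierarchy.incomingEdges (CliqueHierarchy.hierarchicalGraph I) k).encard) ∧
    (∀ (V : Type*) [Finite V] (G : SimpleGraph V), CliqueHierarchy.IsMaximalPlanar G →
      ∀ (I : CliqueHierarchy.InteriorChoice G) (k : CliqueHierarchy.ThreeClique G),
        (CliqueHierarchy.outgoingEdges (CliqueHierarchy.hierarchicalGraph I) k).encard ≤ 1) :=
  ⟨⟨5, CliqueHierarchy.bipyramid, CliqueHierarchy.isMaximalPlanar_bipyramid,
    CliqueHierarchy.bipyramidInterior, CliqueHierarchy.three_le_encard_incomingEdges_bipyramid⟩,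
    fun _ _ _ hG I k => CliqueHierarchy.encard_outgoingEdges_le_one hG I k⟩
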